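/- Let $\mathcal H$ be a separable real Hilbert space, $d\in\mathbb N$, and let $\mathcal H^d$ carry the norm $\|\phi\|^2=\sum_{j=1}^d\|\phi_j\|^2$. For $x\in\mathbb R^d$, $\phi\in\mathcal H^d$ and $y\in\mathcal H$ write $x^{T}\phi=\sum_j x_j\phi_j\in\mathcal H$ and $xy=(x_1y,\dots,x_dy)\in\mathcal H^d$. Let $\beta\in\mathcal H^d$ and, for $i\ge 1$, let $$Y_i=X_i^{T}\beta+U_i ,$$ where the pairs $(X_i,U_i)$ of random elements of $\mathbb R^d\times\mathcal H$ are independent and identically distributed and $U_i$ is independent of $X_i$. Let $(X,U)$ be distributed as $(X_1,U_1)$. Assume that $X$ is bounded almost surely and that: 1. there is a constant $C>0$ such that all eigenvalues of $\Sigma=\mathbb E(XX^{T})$ lie in $[1/C,C]$; 2. $U$ has a unique geometric median at zero, i.e. $0$ is the unique minimizer over $h\in\mathcal H$ of $\mathbb E\{\|U-h\|-\|U\|\}$; 3. there is a constant $C>0$ such that $\mathbb E\{\|U-h\|^{-2}\}\le C$ for all $h\in\mathcal H$; 4. $\gamma_n=\gamma n^{-\alpha}$ with $\gamma>0$ and $\alpha<1$,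 $\sum_{n\ge1}\gamma_n=\infty$ and $\sum_{n\ge1}\gamma_n^2<\infty$ (that is, $1/2<\alpha<1$). Let $\beta_1$ be an almost surely bounded random element of $\mathcal H^d$ that is independent of $(X_i,U_i)_{i\ge2}$ (for example a constant), and for $n\ge 1$ let $$\beta_{n+1}=\beta_n+\gamma_n\,\frac{X_{n+1}(Y_{n+1}-X_{n+1}^{T}\beta_n)}{\|Y_{n+1}-X_{n+1}^{T}\beta_n\|}$$ (the last term is read as $0$ where the denominator vanishes). Then $\mathbb E\{\|\beta_n-\beta\|^2\}$ and $\mathbb E\{\|\beta_n-\beta\|^4\}$ are finite for all $n\ge1$, $$\mathbb E\{\|\beta_n-\beta\|^2\}=\mathcal O(n^{-\alpha}),\qquad\text{and}\qquad \mathbb E\{\|\beta_n-\beta\|^4\}=\mathcal O(n^{-\theta})\ \text{ for every } \theta\in(\alpha,2\alpha).$$ -/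

import Mathlib

open MeasureTheory ProbabilityTheory Filter Asymptotics
open scoped Topology ENNReal

noncomputable section

namespace FunctionOnScalar

/-- The Hilbert space `H^d`, with `‖φ‖² = ∑ j, ‖φ j‖²`. -/
abbrev HPow (H : Type*) (d : ℕ) : Type _ := PiLp 2 (fun _ : Fin d => H)

section Algebra

variable {H : Type*} [NormedAddCommGroup H] [InnerProductSpace ℝ H] {d : ℕ}

/-- `xᵀ φ = ∑ j, x_j φ_j ∈ H` for `x ∈ ℝ^d` and `φ ∈ H^d`. -/
def dotH (x : EuclideanSpace ℝ (Fin d)) (φ : HPow H d) : H := ∑ j, x j • φ j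

/-- `x y = (x_1 y, …, x_d y) ∈ H^d` for `x ∈ ℝ^d` and `y ∈ H`. -/
def scaleH (x : EuclideanSpace ℝ (Fin d)) (y : H) : HPow H d :=
  WithLp.toLp 2 (fun j => x j • y)

/-- The step sizes `γ_n = γ n^{-α}`. -/
def stepSize (γ α : ℝ) (n : ℕ) : ℝ := γ * (n : ℝ) ^ (-α)

/-- One update `b + s x (y - xᵀ b) / ‖y - xᵀ b‖` with step size `s` and observation `(x, y)`
(the direction is `0` if `y = xᵀ b`). -/
def sgdStep (s : ℝ) (x : EuclideanSpace ℝ (Fin d)) (y : H) (b : HPow H d) : HPow H d :=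
  b + s • (‖y - dotH x b‖⁻¹ • scaleH x (y - dotH x b))

/-- The iterates `β_1, β_2, …` started from `β_1 = b₁`, with
`β_{n+1} = β_n + γ_n X_{n+1} (Y_{n+1} - X_{n+1}ᵀ β_n) / ‖Y_{n+1} - X_{n+1}ᵀ β_n‖` for `n ≥ 1`.
The index `0` is not used; its value is a convention. -/
def sgdIterate {Ω : Type*} (γ α : ℝ) (X : ℕ → Ω → EuclideanSpace ℝ (Fin d)) (Y : ℕ → Ω → H)
    (b₁ : Ω → HPow H d) : ℕ → Ω → HPow H d
  | 0 => b₁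
  | 1 => b₁
  | n + 2 => fun ω =>
      sgdStep (stepSize γ α (n + 1)) (X (n + 2) ω) (Y (n + 2) ω)
        (sgdIterate γ α X Y b₁ (n + 1) ω)

end Algebra

section Probability

variable {Ω : Type*} [MeasurableSpace Ω]

/-- The second-moment matrix `Σ = E(X Xᵀ)`. -/
def secondMoment {d : ℕ} (P : Measure Ω) (X : Ω → EuclideanSpace ℝ (Fin d)) :
    Matrix (Fin d) (Fin d) ℝ :=
  Matrix.of fun i j => ∫ ω, X ω i * X ω j ∂P

theorem secondMoment_isHermitian {d : ℕ} (P : Measure Ω) (X : Ω → EuclideanSpace ℝ (Fin d)) :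
    (secondMoment P X).IsHermitian := by
  ext i j
  simp [secondMoment, Matrix.conjTranspose_apply, mul_comm]

/-- All eigenvalues of `Σ = E(X Xᵀ)` lie in `[1/C, C]` for some `C > 0`. -/
def WellConditioned {d : ℕ} (P : Measure Ω) (X : Ω → EuclideanSpace ℝ (Fin d)) : Prop :=
  ∃ C : ℝ, 0 < C ∧ ∀ i, 1 / C ≤ (secondMoment_isHermitian P X).eigenvalues i ∧
    (secondMoment_isHermitian P X).eigenvalues i ≤ C

/-- `Z` is bounded almost surely. -/
def AEBounded {E : Type*} [Norm E] (P : Measure Ω) (Z : Ω → E) : Prop :=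
  ∃ K : ℝ, ∀ᵐ ω ∂P, ‖Z ω‖ ≤ K

variable {H : Type*} [NormedAddCommGroup H]

/-- `m` is a geometric median of `U`: it minimizes `h ↦ E(‖U - h‖ - ‖U‖)`. -/
def IsGeometricMedian (P : Measure Ω) (U : Ω → H) (m : H) : Prop :=
  ∀ h : H, ∫ ω, (‖U ω - m‖ - ‖U ω‖) ∂P ≤ ∫ ω, (‖U ω - h‖ - ‖U ω‖) ∂P

/-- `0` is the unique geometric median of `U`. -/
def HasUniqueZeroMedian (P : Measure Ω) (U : Ω → H) : Prop :=
  IsGeometricMedian P U 0 ∧ ∀ m : H, IsGeometricMedian P U m → m = 0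

/-- `U` is not strongly concentrated around a point: `E(‖U - h‖^{-2}) ≤ C` for all `h`. The
expectation is taken in `[0, ∞]`, with `‖U - h‖^{-2} = ∞` where `U = h`. -/
def NotConcentrated (P : Measure Ω) (U : Ω → H) : Prop :=
  ∃ C : ℝ, 0 < C ∧ ∀ h : H, ∫⁻ ω, (‖U ω - h‖ₑ ^ 2)⁻¹ ∂P ≤ ENNReal.ofReal C

/-- `(X_i, Y_i)`, `i ≥ 1`, is a sample from the function-on-scalar regression model with slope
`β ∈ H^d`: `Y_i = X_iᵀ β + U_i`, where the pairs `(X_i, U_i)` are independent and identically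
distributed and `U_i` is independent of `X_i`. The index `0` is not used. -/
structure IsSample [InnerProductSpace ℝ H] [MeasurableSpace H] {d : ℕ} (P : Measure Ω)
    (β : HPow H d) (X : ℕ → Ω → EuclideanSpace ℝ (Fin d)) (Y U : ℕ → Ω → H) : Prop where
  measurable_X : ∀ i, 1 ≤ i → Measurable (X i)
  measurable_U : ∀ i, 1 ≤ i → Measurable (U i)
  model : ∀ i, 1 ≤ i → ∀ ω, Y i ω = dotH (X i ω) β + U i ω
  indep : iIndepFun (fun (i : ℕ) ω => (X (i + 1) ω, U (i + 1) ω)) P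
  identDistrib : ∀ i, 1 ≤ i →
    IdentDistrib (fun ω => (X i ω, U i ω)) (fun ω => (X 1 ω, U 1 ω)) P P
  indep_XU : IndepFun (X 1) (U 1) P

end Probability

/-- The Robbins–Monro conditions `∑ s_n = ∞` and `∑ s_n² < ∞`, the sums over `n ≥ 1`. -/
def RobbinsMonro (s : ℕ → ℝ) : Prop :=
  Tendsto (fun N : ℕ => ∑ n ∈ Finset.Icc 1 N, s n) atTop atTop ∧
    Summable (fun n : ℕ => s (n + 1) ^ 2)

end FunctionOnScalar

end

/-!
Write `T = β_n - β` for the error. An update is `T ↦ T + γ_n ξ` with `ξ = X (U - Xᵀ T) / ‖U - Xᵀ T‖`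
and `(X, U)` independent of `T`, so everything rests on the mean drift `E ⟪t, ξ⟫` at a fixed error
`t`, and on a Lyapunov function for which this drift contracts globally.

*Drift.* Write `e(u) = u / ‖u‖`. A planar computation (`inner_direction_sub_direction_ge`) gives
`⟪h, e(u) - e(u - h)⟫ ≥ (‖h‖² - ⟪e(u), h⟫²) / (2 (M + ‖h‖))` for `0 < ‖u‖ ≤ M`; the right side
involves `u` only through its angle with `h`. The bound on `E ‖U - h‖⁻²` forbids mass on lines
through `0` (`measure_line_eq_zero`), and comparing two independent copies of `U` turns this into a
bound for the mean squared sine that is uniform over all lines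
(`exists_forall_integral_one_sub_inner_sq_ge`); no compactness is needed, so the dimension plays no
role. Since `E ⟪h, e(U)⟫ ≤ 0` at the median, `E ⟪h, e(U - h)⟫ ≤ -c ‖h‖² / (1 + ‖h‖)` for *all* `h`.
Taking `h = Xᵀ t` and using that `Σ` is positive definite gives `E ⟪t, ξ⟫ ≤ -c ‖t‖² / (1 + ‖t‖)`.

*Lyapunov function.* The drift is only linear at infinity, which is not enough to contract `‖t‖²`.
It does contract `W t = exp (l (√(1 + ‖t‖²) - 1)) - 1`, which behaves like `‖t‖²` near `0` and
exponentially at infinity. For small `l` the second-order expansions of `W` and `W²` give `E[W(T')]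
≤ (1 - c γ_n + D γ_n²) E[W(T)] + D γ_n²` and, the remainder for `W²` being of order `γ_n² (W + W²) +
γ_n⁴`, `E[W(T')²] ≤ (1 - c γ_n + D γ_n²) E[W(T)²] + D γ_n² E[W(T)] + D γ_n⁴`.

*Rates.* As `α < 1`, these recursions (`exists_forall_le_of_recursion`) yield `E[W(T)] = O(γ_n)`,
and with this `E[W(T)²] = O(γ_n²)`. Since `‖t‖²` is at most a multiple of `W t`, the second moment
of the error is `O(n^{-α})` and the fourth one even `O(n^{-2 α})`.
-/

noncomputable section

namespace FunctionOnScalar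

/-! ### Monotonicity of the direction field in a Hilbert space -/

section Direction

variable {H : Type*} [NormedAddCommGroup H] [InnerProductSpace ℝ H]

/-- The direction `u / ‖u‖` of `u`, with value `0` at `u = 0`. -/
def direction (u : H) : H := ‖u‖⁻¹ • u

theorem norm_smul_direction (u : H) : ‖u‖ • direction u = u := by
  by_cases hu : u = 0
  · simp [hu, direction]
  · rw [direction, smul_smul, mul_inv_cancel₀ (norm_ne_zero_iff.2 hu), one_smul]

theorem norm_direction {u : H} (hu : u ≠ 0) : ‖direction u‖ = 1 := by
  rw [direction, norm_smul, norm_inv, norm_norm, inv_mul_cancel₀ (norm_ne_zero_iff.2 hu)]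

theorem norm_direction_le (u : H) : ‖direction u‖ ≤ 1 := by
  by_cases hu : u = 0
  · simp [hu, direction]
  · exact (norm_direction hu).le

theorem abs_inner_direction_le (h u : H) : |inner ℝ h (direction u)| ≤ ‖h‖ :=
  (abs_real_inner_le_norm _ _).trans
    (mul_le_of_le_one_right (norm_nonneg h) (norm_direction_le u))

theorem measurable_direction [MeasurableSpace H] [BorelSpace H] [SecondCountableTopology H] :
    Measurable (direction : H → H) := by
  unfold direction
  fun_prop

theorem inner_sub_direction {u w : H} (hu : u ≠ 0) (hw : w ≠ 0) :
    inner ℝ (u - w) (direction u - direction w) =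
      (‖u‖ + ‖w‖) * (1 - inner ℝ (direction u) (direction w)) := by
  have h1 := norm_direction hu
  have h2 := norm_direction hw
  conv_lhs => rw [← norm_smul_direction u, ← norm_smul_direction w]
  rw [norm_smul_direction u, norm_smul_direction w]
  nth_rewrite 1 [← norm_smul_direction u, ← norm_smul_direction w]
  simp only [inner_sub_left, inner_sub_right, real_inner_smul_left, real_inner_self_eq_norm_sq,
    h1, h2, real_inner_comm (direction u) (direction w)]
  ring

theorem norm_sq_sub_inner_direction_sq {u w : H} (hu : u ≠ 0) (hw : w ≠ 0) :
    ‖u - w‖ ^ 2 - inner ℝ (direction u) (u - w) ^ 2 =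
      ‖w‖ ^ 2 * (1 - inner ℝ (direction u) (direction w) ^ 2) := by
  have h1 := norm_direction hu
  have h2 := norm_direction hw
  set a := direction u with ha
  set b := direction w with hb
  have e1 : inner ℝ a u = ‖u‖ := by
    conv_lhs => rw [← norm_smul_direction u]
    rw [real_inner_smul_right, ← ha, real_inner_self_eq_norm_sq, h1]; ring
  have e2 : inner ℝ a w = ‖w‖ * inner ℝ a b := by
    conv_lhs => rw [← norm_smul_direction w]
    rw [real_inner_smul_right]
  have e3 : inner ℝ u w = ‖u‖ * (‖w‖ * inner ℝ a b) := by
    conv_lhs => rw [← norm_smul_direction u]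
    rw [real_inner_smul_left, ← ha, e2]
  rw [norm_sub_sq_real, inner_sub_right, e1, e2, e3]
  ring

/-- Quantitative monotonicity of the direction field: the component of `h` orthogonal to `u`
contributes to the monotonicity gap with a weight depending on `u` only through its norm. -/
theorem inner_direction_sub_direction_ge {u h : H} {M : ℝ} (hu : u ≠ 0) (hM : ‖u‖ ≤ M) :
    (‖h‖ ^ 2 - inner ℝ (direction u) h ^ 2) / (2 * (M + ‖h‖)) ≤
      inner ℝ h (direction u - direction (u - h)) := by
  have hu0 : 0 < ‖u‖ := norm_pos_iff.2 hu
  have hpos : 0 < M + ‖h‖ := by have := norm_nonneg h; linarith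
  by_cases hw : u - h = 0
  · obtain rfl : u = h := sub_eq_zero.1 hw
    have : inner ℝ u (direction u) = ‖u‖ := by
      rw [direction, real_inner_smul_right, real_inner_self_eq_norm_sq]; field_simp
    rw [hw, real_inner_comm, this, inner_sub_right, this]
    simp [direction]
  · have e1 := inner_sub_direction hu hw
    have e2 := norm_sq_sub_inner_direction_sq hu hw
    rw [sub_sub_cancel] at e1 e2
    rw [e1, e2, div_le_iff₀ (by positivity)]
    set c := inner ℝ (direction u) (direction (u - h)) with hc
    have hc1 : c ≤ 1 := by
      have := (abs_le.1 (abs_inner_direction_le (direction u) (u - h))).2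
      rw [norm_direction hu] at this
      exact this
    have hb : ‖u - h‖ ≤ M + ‖h‖ := (norm_sub_le _ _).trans (by linarith)
    have hb0 := norm_nonneg (u - h)
    have : ‖u - h‖ ^ 2 * (1 - c ^ 2) ≤ ‖u - h‖ ^ 2 * (2 * (1 - c)) := by
      apply mul_le_mul_of_nonneg_left _ (sq_nonneg _)
      nlinarith [sq_nonneg (1 - c)]
    have h3 : ‖u - h‖ ^ 2 ≤ (‖u‖ + ‖u - h‖) * (M + ‖h‖) := by nlinarith
    nlinarith [mul_le_mul_of_nonneg_right h3 (show 0 ≤ 2 * (1 - c) by linarith)]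

theorem inner_direction_sub_direction_nonneg {u h : H} (hu : u ≠ 0) :
    0 ≤ inner ℝ h (direction u - direction (u - h)) := by
  refine le_trans ?_ (inner_direction_sub_direction_ge hu le_rfl)
  have h1 := abs_inner_direction_le h u
  rw [real_inner_comm] at h1
  have := sq_le_sq' (by linarith [(abs_le.1 h1).1]) (abs_le.1 h1).2
  have := norm_nonneg h
  have := norm_nonneg u
  apply div_nonneg <;> nlinarith

/-- The squared sine of the angle between lines satisfies the triangle inequality up to a factor
`2`. -/
theorem one_sub_inner_sq_le {a b e : H} (ha : ‖a‖ = 1) (hb : ‖b‖ = 1) (he : ‖e‖ = 1) :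
    1 - inner ℝ a b ^ 2 ≤ 2 * (1 - inner ℝ a e ^ 2) + 2 * (1 - inner ℝ b e ^ 2) := by
  set x := inner ℝ a e with hx
  set y := inner ℝ b e with hy
  have hx1 : |x| ≤ 1 := by simpa [ha, he] using abs_real_inner_le_norm a e
  have hy1 : |y| ≤ 1 := by simpa [hb, he] using abs_real_inner_le_norm b e
  -- `a - x y b` is the sum of `a - x e` and `x (e - y b)`
  have h1 : ‖(a - x • e) + x • (e - y • b)‖ ^ 2 = 1 - 2 * (x * y) * inner ℝ a b + (x * y) ^ 2 := by
    have : (a - x • e) + x • (e - y • b) = a - (x * y) • b := by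
      rw [smul_sub, smul_smul]; abel
    rw [this, norm_sub_sq_real, real_inner_smul_right, norm_smul, ha, hb, mul_one,
      Real.norm_eq_abs, sq_abs]; ring
  have h2 : ‖a - x • e‖ ^ 2 = 1 - x ^ 2 := by
    rw [norm_sub_sq_real, real_inner_smul_right, norm_smul, ha, he, mul_one,
      Real.norm_eq_abs, sq_abs, ← hx]; ring
  have h3 : ‖x • (e - y • b)‖ ^ 2 = x ^ 2 * (1 - y ^ 2) := by
    rw [norm_smul, mul_pow, norm_sub_sq_real, real_inner_smul_right, norm_smul, hb, he, mul_one,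
      Real.norm_eq_abs, Real.norm_eq_abs, sq_abs, sq_abs, real_inner_comm, ← hy]; ring
  have h4 := norm_add_le (a - x • e) (x • (e - y • b))
  have h5 : ‖(a - x • e) + x • (e - y • b)‖ ^ 2 ≤
      2 * ‖a - x • e‖ ^ 2 + 2 * ‖x • (e - y • b)‖ ^ 2 := by
    have := norm_nonneg ((a - x • e) + x • (e - y • b))
    nlinarith [sq_nonneg (‖a - x • e‖ - ‖x • (e - y • b)‖)]
  rw [h1, h2, h3] at h5
  have hx2 : x ^ 2 ≤ 1 := (sq_le_one_iff_abs_le_one x).2 hx1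
  have hy2 : y ^ 2 ≤ 1 := (sq_le_one_iff_abs_le_one y).2 hy1
  nlinarith [sq_nonneg (x * y - inner ℝ a b), mul_nonneg (sub_nonneg.2 hx2) (sub_nonneg.2 hy2)]

/-- First-order upper bound for the norm at `u ≠ 0`. -/
theorem norm_sub_sub_norm_le {u : H} (hu : u ≠ 0) (h : H) :
    ‖u - h‖ - ‖u‖ ≤ -inner ℝ h (direction u) + ‖h‖ ^ 2 / 2 * ‖u‖⁻¹ := by
  have hu0 : 0 < ‖u‖ := norm_pos_iff.2 hu
  have e := norm_sub_sq_real u h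
  rw [direction, real_inner_smul_right, real_inner_comm]
  have key : (‖u - h‖ - ‖u‖) * ‖u‖ ≤ -inner ℝ u h + ‖h‖ ^ 2 / 2 := by
    nlinarith [sq_nonneg (‖u - h‖ - ‖u‖)]
  have : ‖u - h‖ - ‖u‖ ≤ (-inner ℝ u h + ‖h‖ ^ 2 / 2) * ‖u‖⁻¹ := by
    rwa [← div_eq_mul_inv, le_div_iff₀ hu0]
  linarith

end Direction

/-! ### Coercivity of the geometric median functional -/

section Coercivity

variable {H : Type*} [NormedAddCommGroup H] [MeasurableSpace H] [BorelSpace H]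

theorem measure_closedBall_le {μ : Measure H} {C : ℝ≥0∞}
    (hμ : ∀ h : H, ∫⁻ u, (‖u - h‖ₑ ^ 2)⁻¹ ∂μ ≤ C) (h : H) {ρ : ℝ} (hρ : 0 < ρ) :
    μ (Metric.closedBall h ρ) ≤ C * ENNReal.ofReal ρ ^ 2 := by
  have h1 := mul_meas_ge_le_lintegral₀ (μ := μ) (f := fun u => (‖u - h‖ₑ ^ 2)⁻¹)
    (by fun_prop) ((ENNReal.ofReal ρ ^ 2)⁻¹)
  have h2 : Metric.closedBall h ρ ⊆ {u | (ENNReal.ofReal ρ ^ 2)⁻¹ ≤ (‖u - h‖ₑ ^ 2)⁻¹} := by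
    intro u hu
    rw [mem_closedBall_iff_norm] at hu
    rw [Set.mem_ofPred_eq, ENNReal.inv_le_inv, ← ofReal_norm]
    gcongr
  have h0 : ENNReal.ofReal ρ ^ 2 ≠ 0 := by simpa using hρ
  have htop : ENNReal.ofReal ρ ^ 2 ≠ ∞ := by finiteness
  have h3 := (mul_le_mul_right (measure_mono (μ := μ) h2) _).trans (h1.trans (hμ h))
  rw [mul_comm C, ← ENNReal.inv_mul_le_iff h0 htop]
  exact h3

theorem ae_ne_of_lintegral_inv_le {μ : Measure H} {C : ℝ≥0∞} (hC : C ≠ ∞)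
    (hμ : ∀ h : H, ∫⁻ u, (‖u - h‖ₑ ^ 2)⁻¹ ∂μ ≤ C) (h : H) : ∀ᵐ u ∂μ, u ≠ h := by
  filter_upwards [ae_lt_top' (by fun_prop) ((hμ h).trans_lt hC.lt_top).ne] with u hu huh
  simp [huh] at hu

variable [InnerProductSpace ℝ H]

/-- Bounded second inverse moments exclude any mass on a line (stated for lines through `0`): a
segment of length `ℓ` is covered by `N + 1` balls of radius `ℓ / N`, of total mass `O(N · N⁻²)`. -/
theorem measure_line_eq_zero {μ : Measure H} {C : ℝ≥0∞} (hC : C ≠ ∞)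
    (hμ : ∀ h : H, ∫⁻ u, (‖u - h‖ₑ ^ 2)⁻¹ ∂μ ≤ C) {v : H} (hv : v ≠ 0) :
    μ {u | ∃ t : ℝ, u = t • v} = 0 := by
  have hsub : {u | ∃ t : ℝ, u = t • v} ⊆
      ⋃ m : ℤ, {u | ∃ t : ℝ, t ∈ Set.Icc (0 : ℝ) 1 ∧ u = ((m : ℝ) + t) • v} := by
    rintro u ⟨t, rfl⟩
    refine Set.mem_iUnion.2 ⟨⌊t⌋, Int.fract t, ⟨Int.fract_nonneg t, (Int.fract_lt_one t).le⟩, ?_⟩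
    rw [Int.floor_add_fract]
  refine measure_mono_null hsub (measure_iUnion_null fun m => ?_)
  set D : ℝ≥0∞ := 2 * C * ENNReal.ofReal ‖v‖ ^ 2 with hD
  have hDtop : D ≠ ∞ := by rw [hD]; finiteness
  have hbound : ∀ N : ℕ, 0 < N →
      μ {u | ∃ t : ℝ, t ∈ Set.Icc (0 : ℝ) 1 ∧ u = ((m : ℝ) + t) • v} ≤ D / N := by
    intro N hN
    have hN' : (0 : ℝ) < N := Nat.cast_pos.2 hN
    have hcov : {u | ∃ t : ℝ, t ∈ Set.Icc (0 : ℝ) 1 ∧ u = ((m : ℝ) + t) • v} ⊆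
        ⋃ k ∈ Finset.range (N + 1),
          Metric.closedBall (((m : ℝ) + (k : ℝ) / N) • v) (‖v‖ / N) := by
      rintro u ⟨t, ⟨ht0, ht1⟩, rfl⟩
      have h0 : 0 ≤ t * N := by positivity
      have hk : ⌊t * N⌋₊ < N + 1 := by
        rw [Nat.floor_lt h0]; push_cast; nlinarith
      refine Set.mem_biUnion (Finset.mem_coe.2 (Finset.mem_range.2 hk)) ?_
      rw [mem_closedBall_iff_norm, ← sub_smul, norm_smul, add_sub_add_left_eq_sub,
        div_eq_inv_mul ‖v‖]
      apply mul_le_mul_of_nonneg_right _ (norm_nonneg v)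
      have e : t - (⌊t * N⌋₊ : ℝ) / N = (t * N - ⌊t * N⌋₊) * (N : ℝ)⁻¹ := by field_simp
      rw [e, Real.norm_eq_abs, abs_mul, abs_of_pos (inv_pos.2 hN')]
      apply mul_le_of_le_one_left (inv_pos.2 hN').le
      rw [abs_le]
      have := Nat.floor_le h0
      have := Nat.lt_floor_add_one (t * N)
      constructor <;> linarith
    have hN0 : (N : ℝ≥0∞) ≠ 0 := by exact_mod_cast hN.ne'
    have hNt : (N : ℝ≥0∞) ≠ ∞ := ENNReal.natCast_ne_top N
    calc _ ≤ ∑ k ∈ Finset.range (N + 1),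
          μ (Metric.closedBall (((m : ℝ) + (k : ℝ) / N) • v) (‖v‖ / N)) :=
          (measure_mono hcov).trans (measure_biUnion_finset_le _ _)
      _ ≤ ∑ _k ∈ Finset.range (N + 1), C * ENNReal.ofReal (‖v‖ / N) ^ 2 :=
          Finset.sum_le_sum fun k _ =>
            measure_closedBall_le hμ _ (div_pos (norm_pos_iff.2 hv) hN')
      _ = (N + 1 : ℝ≥0∞) * (C * ENNReal.ofReal ‖v‖ ^ 2 * ((N : ℝ≥0∞)⁻¹ * (N : ℝ≥0∞)⁻¹)) := by
          rw [Finset.sum_const, Finset.card_range, nsmul_eq_mul,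
            ENNReal.ofReal_div_of_pos hN', ENNReal.ofReal_natCast, div_eq_mul_inv]
          push_cast; ring
      _ ≤ (2 * N : ℝ≥0∞) * (C * ENNReal.ofReal ‖v‖ ^ 2 * ((N : ℝ≥0∞)⁻¹ * (N : ℝ≥0∞)⁻¹)) := by
          gcongr
          rw [two_mul]
          gcongr
          exact_mod_cast hN
      _ = D / N * ((N : ℝ≥0∞) * (N : ℝ≥0∞)⁻¹) := by rw [hD, div_eq_mul_inv]; ring
      _ = D / N := by rw [ENNReal.mul_inv_cancel hN0 hNt, mul_one]
  have hlim : Tendsto (fun N : ℕ => D / (N : ℝ≥0∞)) atTop (𝓝 0) := by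
    have := ENNReal.Tendsto.const_mul ENNReal.tendsto_inv_nat_nhds_zero (Or.inr hDtop)
    simpa [div_eq_mul_inv] using this
  refine le_antisymm (ge_of_tendsto hlim ?_) (zero_le)
  filter_upwards [eventually_gt_atTop 0] with N hN using hbound N hN

variable [SecondCountableTopology H]

theorem integrable_inner_direction (μ : Measure H) [IsFiniteMeasure μ] (g h : H) :
    Integrable (fun u => inner ℝ g (direction (u - h))) μ := by
  have hm : Measurable (fun u : H => direction (u - h)) :=
    measurable_direction.comp (measurable_id.sub_const h)
  refine Integrable.of_bound (C := ‖g‖)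
    (measurable_const.inner hm).aestronglyMeasurable (ae_of_all _ fun u => ?_)
  exact abs_inner_direction_le g _

/-- If no line through `0` carries mass, the directions of `u` are spread in all directions: the
mean squared sine of the angle with a line is bounded below over all lines. Two independent copies
of `u` have a positive mean squared sine `κ`, and both cannot be close to the same line. -/
theorem exists_forall_integral_one_sub_inner_sq_ge {ν : Measure H} [IsFiniteMeasure ν]
    (hν : ν ≠ 0) (h0 : ∀ᵐ u ∂ν, u ≠ 0)
    (hline : ∀ v : H, v ≠ 0 → ν {u | ∃ t : ℝ, u = t • v} = 0) :
    ∃ κ : ℝ, 0 < κ ∧ ∀ e : H, ‖e‖ = 1 → κ ≤ ∫ u, (1 - inner ℝ (direction u) e ^ 2) ∂ν := by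
  have hmd : Measurable (direction : H → H) := measurable_direction
  set p : ℝ := ν.real Set.univ with hp
  have hp0 : 0 < p := by
    rw [hp, measureReal_def]
    exact ENNReal.toReal_pos (by simpa using hν) (measure_ne_top _ _)
  have hle : ∀ u e : H, ‖e‖ ≤ 1 → inner ℝ (direction u) e ^ 2 ≤ 1 := by
    intro u e he
    rw [sq_le_one_iff_abs_le_one, real_inner_comm]
    exact (abs_inner_direction_le e u).trans he
  have hint : ∀ e : H, ‖e‖ ≤ 1 →
      Integrable (fun u => 1 - inner ℝ (direction u) e ^ 2) ν := by
    intro e he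
    refine Integrable.of_bound (C := 1) (by fun_prop) (ae_of_all _ fun u => ?_)
    rw [Real.norm_eq_abs, abs_le]
    constructor <;> nlinarith [hle u e he, sq_nonneg (inner ℝ (direction u) e)]
  let J : H → ℝ := fun v => ∫ u, (1 - inner ℝ (direction u) (direction v) ^ 2) ∂ν
  have hJm : StronglyMeasurable J := by
    apply StronglyMeasurable.integral_prod_right (f := fun v u =>
      1 - inner ℝ (direction u) (direction v) ^ 2)
    apply Measurable.stronglyMeasurable
    simp only [Function.uncurry_def]
    fun_prop
  have hJ0 : ∀ v, 0 ≤ J v := fun v =>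
    integral_nonneg fun u => sub_nonneg.2 (hle u _ (norm_direction_le v))
  have hJle : ∀ v, J v ≤ p := by
    intro v
    calc J v ≤ ∫ _u, (1 : ℝ) ∂ν :=
          integral_mono (hint _ (norm_direction_le v)) (integrable_const _)
            fun u => by have := sq_nonneg (inner ℝ (direction u) (direction v)); simpa using this
      _ = p := by simp [hp]
  have hJint : Integrable J ν := by
    refine Integrable.of_bound (C := p) hJm.aestronglyMeasurable (ae_of_all _ fun v => ?_)
    rw [Real.norm_eq_abs, abs_of_nonneg (hJ0 v)]
    exact hJle v
  have hJpos : ∀ v, v ≠ 0 → 0 < J v := by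
    intro v hv
    refine (hJ0 v).lt_of_ne' fun hJv => hν ?_
    have h1 := (integral_eq_zero_iff_of_nonneg
      (fun u => sub_nonneg.2 (hle u _ (norm_direction_le v)))
      (hint _ (norm_direction_le v))).1 hJv
    have hl := hline v hv
    rw [measure_eq_zero_iff_ae_notMem] at hl
    rw [← ae_eq_bot, ← Filter.eventually_false_iff_eq_bot]
    filter_upwards [h1, hl, h0] with u hu hul hu0
    apply hul
    have h2 : |inner ℝ (direction u) (direction v)| = ‖direction u‖ * ‖direction v‖ := by
      rw [norm_direction hu0, norm_direction hv, mul_one, ← sq_eq_sq₀ (abs_nonneg _) zero_le_one,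
        sq_abs]
      simp only [Pi.zero_apply] at hu
      linarith
    have hdv : direction v ≠ 0 := by
      rw [← norm_ne_zero_iff, norm_direction hv]; exact one_ne_zero
    have hdu : direction u ≠ 0 := by
      rw [← norm_ne_zero_iff, norm_direction hu0]; exact one_ne_zero
    obtain ⟨-, r, -, hr⟩ := (abs_real_inner_div_norm_mul_norm_eq_one_iff _ _).1
      (by rw [abs_div, real_inner_comm, h2, abs_of_nonneg (by positivity), mul_comm, div_self]
          exact mul_ne_zero (norm_ne_zero_iff.2 hdv) (norm_ne_zero_iff.2 hdu)
        : |inner ℝ (direction v) (direction u) / (‖direction v‖ * ‖direction u‖)| = 1)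
    refine ⟨‖u‖ * (r * ‖v‖⁻¹), ?_⟩
    conv_lhs => rw [← norm_smul_direction u, hr, direction]
    simp only [smul_smul]
  set κ := ∫ v, J v ∂ν with hκ
  have hκ0 : 0 < κ := by
    refine lt_of_le_of_ne (integral_nonneg hJ0) fun h => hν ?_
    have h1 := (integral_eq_zero_iff_of_nonneg hJ0 hJint).1 h.symm
    rw [← ae_eq_bot, ← Filter.eventually_false_iff_eq_bot]
    filter_upwards [h1, h0] with v hv hv0
    exact (hJpos v hv0).ne' hv
  refine ⟨κ / (4 * p), by positivity, fun e he => ?_⟩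
  set I := ∫ u, (1 - inner ℝ (direction u) e ^ 2) ∂ν with hI
  have hinte := hint e he.le
  have hJI : ∀ v, v ≠ 0 → J v ≤ 2 * I + 2 * p * (1 - inner ℝ (direction v) e ^ 2) := by
    intro v hv
    calc J v ≤ ∫ u, (2 * (1 - inner ℝ (direction u) e ^ 2)
            + 2 * (1 - inner ℝ (direction v) e ^ 2)) ∂ν := by
          refine integral_mono_ae (hint _ (norm_direction_le v))
            ((hinte.const_mul 2).add (integrable_const _)) ?_
          filter_upwards [h0] with u hu
          exact one_sub_inner_sq_le (norm_direction hu) (norm_direction hv) he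
      _ = 2 * I + 2 * p * (1 - inner ℝ (direction v) e ^ 2) := by
          rw [integral_add (hinte.const_mul 2) (integrable_const _), integral_const_mul,
            integral_const, smul_eq_mul, ← hp, ← hI]
          ring
  have : κ ≤ 4 * p * I := by
    calc κ ≤ ∫ v, (2 * I + 2 * p * (1 - inner ℝ (direction v) e ^ 2)) ∂ν := by
          refine integral_mono_ae hJint ((integrable_const _).add (hinte.const_mul _)) ?_
          filter_upwards [h0] with v hv using hJI v hv
      _ = 4 * p * I := by
          rw [integral_add (integrable_const _) (hinte.const_mul _), integral_const,
            integral_const_mul (2 * p), smul_eq_mul, ← hp, ← hI]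
          ring
  rw [div_le_iff₀ (by positivity)]
  linarith

/-- First-order optimality of the median `0`, in the direction `h`. -/
theorem integral_inner_direction_nonpos {μ : Measure H} [IsFiniteMeasure μ]
    {C : ℝ≥0∞} (hC : C ≠ ∞) (hμ : ∀ h : H, ∫⁻ u, (‖u - h‖ₑ ^ 2)⁻¹ ∂μ ≤ C)
    (hmed : ∀ h : H, 0 ≤ ∫ u, (‖u - h‖ - ‖u‖) ∂μ) (h : H) :
    ∫ u, inner ℝ h (direction u) ∂μ ≤ 0 := by
  have hne := ae_ne_of_lintegral_inv_le hC hμ 0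
  have hinv2 : Integrable (fun u : H => (‖u‖ ^ 2)⁻¹) μ := by
    refine ⟨by fun_prop, ?_⟩
    refine lt_of_le_of_lt (lintegral_mono_ae ?_) ((hμ 0).trans_lt hC.lt_top)
    filter_upwards [hne] with u hu
    have hu0 : 0 < ‖u‖ := norm_pos_iff.2 hu
    rw [sub_zero, ← ofReal_norm, ← ofReal_norm, Real.norm_eq_abs,
      abs_of_pos (by positivity), ENNReal.ofReal_inv_of_pos (by positivity),
      ENNReal.ofReal_pow hu0.le]
  have hinv : Integrable (fun u : H => ‖u‖⁻¹) μ := by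
    refine ((integrable_const (1 : ℝ)).add hinv2).mono' (by fun_prop) (ae_of_all _ fun u => ?_)
    rw [norm_inv, norm_norm, Pi.add_apply, ← inv_pow]
    nlinarith [sq_nonneg (‖u‖⁻¹ - 1)]
  set B := ‖h‖ ^ 2 / 2 * ∫ u : H, ‖u‖⁻¹ ∂μ with hB
  have hind : Integrable (fun u => inner ℝ h (direction u)) μ := by
    simpa using integrable_inner_direction μ h 0
  have key : ∀ t : ℝ, 0 < t → ∫ u, inner ℝ h (direction u) ∂μ ≤ t * B := by
    intro t ht
    have h1 : 0 ≤ ∫ u, (-t * inner ℝ h (direction u) + t ^ 2 * ‖h‖ ^ 2 / 2 * ‖u‖⁻¹) ∂μ := by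
      refine (hmed (t • h)).trans (integral_mono_ae ?_ ?_ ?_)
      · refine Integrable.of_bound (C := ‖t • h‖) (by fun_prop) (ae_of_all _ fun u => ?_)
        have := abs_norm_sub_norm_le (u - t • h) u
        rwa [sub_sub_cancel_left, norm_neg] at this
      · exact (hind.const_mul _).add (hinv.const_mul _)
      · filter_upwards [hne] with u hu
        have := norm_sub_sub_norm_le hu (t • h)
        rw [real_inner_smul_left, norm_smul, mul_pow, Real.norm_eq_abs, sq_abs] at this
        linarith
    rw [integral_add (hind.const_mul _) (hinv.const_mul _), integral_const_mul,
      integral_const_mul] at h1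
    have h2 : 0 ≤ t * (t * B - ∫ u, inner ℝ h (direction u) ∂μ) := by rw [hB]; linarith
    linarith [nonneg_of_mul_nonneg_right h2 ht]
  have hlim : Tendsto (fun t : ℝ => t * B) (𝓝[>] 0) (𝓝 0) := by
    have : Tendsto (fun t : ℝ => t * B) (𝓝 0) (𝓝 (0 * B)) := by
      exact (continuous_id.mul continuous_const).tendsto 0
    rw [zero_mul] at this
    exact this.mono_left nhdsWithin_le_nhds
  exact ge_of_tendsto hlim (eventually_nhdsWithin_of_forall fun t ht => key t ht)

/-- Coercivity of the gradient of `h ↦ E(‖U - h‖ - ‖U‖)`: quadratic near the median and linear at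
infinity. -/
theorem exists_forall_integral_inner_direction_le {μ : Measure H} [IsProbabilityMeasure μ]
    {C : ℝ≥0∞} (hC : C ≠ ∞) (hμ : ∀ h : H, ∫⁻ u, (‖u - h‖ₑ ^ 2)⁻¹ ∂μ ≤ C)
    (hmed : ∀ h : H, 0 ≤ ∫ u, (‖u - h‖ - ‖u‖) ∂μ) :
    ∃ c : ℝ, 0 < c ∧
      ∀ h : H, ∫ u, inner ℝ h (direction (u - h)) ∂μ ≤ -(c * ‖h‖ ^ 2 / (1 + ‖h‖)) := by
  have hmd : Measurable (direction : H → H) := measurable_direction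
  have hne := ae_ne_of_lintegral_inv_le hC hμ 0
  obtain ⟨M, hM0, hM⟩ : ∃ M : ℝ, 0 ≤ M ∧ μ (Metric.closedBall 0 M) ≠ 0 := by
    by_contra! hcon
    have : μ (⋃ N : ℕ, Metric.closedBall (0 : H) N) = 0 :=
      measure_iUnion_null fun N => hcon N N.cast_nonneg
    rw [Metric.iUnion_closedBall_nat] at this
    exact IsProbabilityMeasure.ne_zero μ (Measure.measure_univ_eq_zero.1 this)
  set S := Metric.closedBall (0 : H) M with hS
  have hSm : MeasurableSet S := Metric.isClosed_closedBall.measurableSet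
  obtain ⟨κ, hκ0, hκ⟩ := exists_forall_integral_one_sub_inner_sq_ge (ν := μ.restrict S)
    (by rwa [Ne, Measure.restrict_eq_zero]) (ae_restrict_of_ae hne) (fun v hv =>
      Measure.absolutelyContinuous_of_le Measure.restrict_le_self (measure_line_eq_zero hC hμ hv))
  refine ⟨κ / (2 * (M + 1)), by positivity, fun h => ?_⟩
  by_cases hh : h = 0
  · simp [hh]
  have hh0 : 0 < ‖h‖ := norm_pos_iff.2 hh
  have hi1 : Integrable (fun u => inner ℝ h (direction u)) μ := by
    simpa using integrable_inner_direction μ h 0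
  have hi2 := integrable_inner_direction μ h h
  have hi : Integrable (fun u => inner ℝ h (direction u - direction (u - h))) μ := by
    simp only [inner_sub_right]
    exact hi1.sub hi2
  have h1 : κ * ‖h‖ ^ 2 / (2 * (M + ‖h‖)) ≤
      ∫ u, inner ℝ h (direction u - direction (u - h)) ∂μ := by
    calc κ * ‖h‖ ^ 2 / (2 * (M + ‖h‖))
        ≤ (∫ u in S, (1 - inner ℝ (direction u) (direction h) ^ 2) ∂μ)
            * (‖h‖ ^ 2 / (2 * (M + ‖h‖))) := by
          rw [mul_div_assoc]
          exact mul_le_mul_of_nonneg_right (hκ _ (norm_direction hh)) (by positivity)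
      _ = ∫ u in S, (1 - inner ℝ (direction u) (direction h) ^ 2)
            * (‖h‖ ^ 2 / (2 * (M + ‖h‖))) ∂μ := (integral_mul_const _ _).symm
      _ ≤ ∫ u in S, inner ℝ h (direction u - direction (u - h)) ∂μ := by
          refine integral_mono_ae ?_ hi.restrict ?_
          · refine Integrable.mul_const (Integrable.of_bound (C := 1) (by fun_prop)
              (ae_of_all _ fun u => ?_)) _
            have hle : inner ℝ (direction u) (direction h) ^ 2 ≤ 1 := by
              rw [sq_le_one_iff_abs_le_one, real_inner_comm]
              exact (abs_inner_direction_le _ u).trans (norm_direction_le h)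
            rw [Real.norm_eq_abs, abs_le]
            constructor <;> nlinarith [sq_nonneg (inner ℝ (direction u) (direction h))]
          · filter_upwards [ae_restrict_of_ae hne, ae_restrict_mem hSm] with u hu huS
            rw [hS, mem_closedBall_zero_iff] at huS
            refine le_trans (le_of_eq ?_) (inner_direction_sub_direction_ge hu huS)
            have : inner ℝ (direction u) h = ‖h‖ * inner ℝ (direction u) (direction h) := by
              conv_lhs => rw [← norm_smul_direction h]
              rw [real_inner_smul_right]
            rw [this]
            ring
      _ ≤ ∫ u, inner ℝ h (direction u - direction (u - h)) ∂μ := by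
          refine setIntegral_le_integral hi ?_
          filter_upwards [hne] with u hu using inner_direction_sub_direction_nonneg hu
  have h2 := integral_inner_direction_nonpos hC hμ hmed h
  have h3 : ∫ u, inner ℝ h (direction u - direction (u - h)) ∂μ =
      ∫ u, inner ℝ h (direction u) ∂μ - ∫ u, inner ℝ h (direction (u - h)) ∂μ := by
    rw [← integral_sub hi1 hi2]
    simp only [inner_sub_right]
  have h4 : κ / (2 * (M + 1)) * ‖h‖ ^ 2 / (1 + ‖h‖) ≤ κ * ‖h‖ ^ 2 / (2 * (M + ‖h‖)) := by
    rw [div_mul_eq_mul_div, div_div]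
    refine div_le_div_of_nonneg_left (by positivity) (by positivity) ?_
    nlinarith
  linarith

end Coercivity

/-! ### The Lyapunov function -/

section Lyapunov

variable {E : Type*} [NormedAddCommGroup E]

/-- The Lyapunov function `exp (l (√(1 + ‖t‖²) - 1)) - 1`: comparable to `‖t‖²` near `0` and
exponential at infinity, so that a drift of size `‖t‖` in the norm at infinity still contracts it
by a constant factor. -/
def lyapunov (l : ℝ) (t : E) : ℝ := Real.exp (l * (√(1 + ‖t‖ ^ 2) - 1)) - 1

theorem one_le_sqrt_one_add_norm_sq (t : E) : 1 ≤ √(1 + ‖t‖ ^ 2) := by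
  rw [Real.one_le_sqrt]; nlinarith [sq_nonneg ‖t‖]

theorem sq_sqrt_one_add_norm_sq (t : E) : √(1 + ‖t‖ ^ 2) ^ 2 = 1 + ‖t‖ ^ 2 :=
  Real.sq_sqrt (by positivity)

theorem norm_le_sqrt_one_add_norm_sq (t : E) : ‖t‖ ≤ √(1 + ‖t‖ ^ 2) :=
  Real.le_sqrt_of_sq_le (by linarith)

theorem le_lyapunov (l : ℝ) (t : E) : l * (√(1 + ‖t‖ ^ 2) - 1) ≤ lyapunov l t := by
  have := Real.add_one_le_exp (l * (√(1 + ‖t‖ ^ 2) - 1))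
  rw [lyapunov]; linarith

theorem lyapunov_nonneg {l : ℝ} (hl : 0 ≤ l) (t : E) : 0 ≤ lyapunov l t :=
  (mul_nonneg hl (sub_nonneg.2 (one_le_sqrt_one_add_norm_sq t))).trans (le_lyapunov l t)

theorem lyapunov_le_of_norm_le {l : ℝ} (hl : 0 ≤ l) {t : E} {R : ℝ} (hR : ‖t‖ ≤ R) :
    lyapunov l t ≤ Real.exp (l * (√(1 + R ^ 2) - 1)) - 1 := by
  have := norm_nonneg t
  rw [lyapunov]
  gcongr

theorem continuous_lyapunov (l : ℝ) : Continuous (lyapunov l : E → ℝ) := by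
  unfold lyapunov
  fun_prop

theorem norm_sq_le_lyapunov {l : ℝ} (hl : 0 < l) (t : E) :
    ‖t‖ ^ 2 ≤ (2 / l + 2 / l ^ 2) * lyapunov l t := by
  have hs1 := one_le_sqrt_one_add_norm_sq t
  have hs := sq_sqrt_one_add_norm_sq t
  set s := √(1 + ‖t‖ ^ 2)
  have h2 := Real.quadratic_le_exp_of_nonneg (x := l * (s - 1)) (by nlinarith)
  have hW : lyapunov l t = Real.exp (l * (s - 1)) - 1 := rfl
  have h3 : 0 ≤ l * (s - 1) := by nlinarith
  have h4 : s - 1 ≤ lyapunov l t / l := by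
    rw [le_div_iff₀ hl]; nlinarith [sq_nonneg (l * (s - 1))]
  have h5 : (s - 1) ^ 2 ≤ 2 * lyapunov l t / l ^ 2 := by
    rw [le_div_iff₀ (by positivity)]; nlinarith
  have : (2 / l + 2 / l ^ 2) * lyapunov l t = 2 * (lyapunov l t / l) + 2 * lyapunov l t / l ^ 2 := by
    ring
  nlinarith

/-- The relative size of the drift along the Lyapunov function. -/
theorem lyapunov_le_mul_drift {l : ℝ} (hl : 0 ≤ l) (hl1 : l ≤ 1) (t : E) :
    lyapunov l t / 3 ≤
      (1 + lyapunov l t) * (‖t‖ ^ 2 / (√(1 + ‖t‖ ^ 2) * (1 + ‖t‖))) := by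
  have hs1 := one_le_sqrt_one_add_norm_sq t
  have hs := sq_sqrt_one_add_norm_sq t
  have hrs := norm_le_sqrt_one_add_norm_sq t
  have hW0 := lyapunov_nonneg hl t
  have hr := norm_nonneg t
  set s := √(1 + ‖t‖ ^ 2) with hsdef
  set W := lyapunov l t with hWdef
  have hA : 1 + W = Real.exp (l * (s - 1)) := by rw [hWdef, lyapunov]; ring
  -- `1 - exp (-y) ≤ y`
  have h1 : W ≤ (1 + W) * (s - 1) := by
    have h := Real.add_one_le_exp (-(l * (s - 1)))
    have h' : (1 + W) * Real.exp (-(l * (s - 1))) = 1 := by rw [hA, ← Real.exp_add]; simp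
    have : (1 + W) * (-(l * (s - 1)) + 1) ≤ 1 := by
      exact (mul_le_mul_of_nonneg_left h (by linarith)).trans_eq h'
    nlinarith [mul_nonneg (show 0 ≤ 1 + W by linarith)
      (mul_nonneg (sub_nonneg.2 hl1) (sub_nonneg.2 hs1))]
  have h2 : (s - 1) / (s + 1) ≤ ‖t‖ ^ 2 / (s * (1 + ‖t‖)) := by
    rw [div_le_div_iff₀ (by positivity) (by positivity),
      show ‖t‖ ^ 2 = (s - 1) * (s + 1) by linarith, mul_assoc]
    apply mul_le_mul_of_nonneg_left _ (by linarith)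
    nlinarith
  refine le_trans ?_ (mul_le_mul_of_nonneg_left h2 (by linarith))
  rcases le_total s 2 with h | h
  · have : (s - 1) / 3 ≤ (s - 1) / (s + 1) :=
      div_le_div_of_nonneg_left (by linarith) (by linarith) (by linarith)
    nlinarith [mul_le_mul_of_nonneg_left this (show 0 ≤ 1 + W by linarith)]
  · have : 1 / 3 ≤ (s - 1) / (s + 1) := by
      rw [div_le_div_iff₀ (by norm_num) (by linarith)]; linarith
    nlinarith [mul_le_mul_of_nonneg_left this (show 0 ≤ 1 + W by linarith)]

variable [InnerProductSpace ℝ E]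

/-- The common first step of both expansions: the increment is controlled by an exponent `z` whose
only first-order term in the step size is `l g ⟪t, ξ⟫ / √(1 + ‖t‖²)`. -/
theorem exists_lyapunov_add_smul_le {l g K : ℝ} (hl : 0 < l) (hg : 0 ≤ g)
    (hlg : l * (g * K + g ^ 2 * K ^ 2) ≤ 1) {t ξ : E} (hξ : ‖ξ‖ ≤ K) :
    ∃ z : ℝ, z = l * g / √(1 + ‖t‖ ^ 2) * inner ℝ t ξ
          + l * g ^ 2 * K ^ 2 / (2 * √(1 + ‖t‖ ^ 2)) ∧ |z| ≤ 1 ∧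
      z ^ 2 ≤ 2 * l ^ 2 * g ^ 2 * K ^ 2 * (‖t‖ ^ 2 / (1 + ‖t‖ ^ 2)) + l ^ 2 * g ^ 4 * K ^ 4 ∧
      lyapunov l (t + g • ξ) ≤ lyapunov l t + (1 + lyapunov l t) * (z + z ^ 2) := by
  have hs1 := one_le_sqrt_one_add_norm_sq t
  have hs := sq_sqrt_one_add_norm_sq t
  have hrs := norm_le_sqrt_one_add_norm_sq t
  have hr := norm_nonneg t
  have hK : 0 ≤ K := (norm_nonneg ξ).trans hξ
  have hs0 : 0 < √(1 + ‖t‖ ^ 2) := by linarith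
  have hin : |inner ℝ t ξ| ≤ ‖t‖ * K :=
    (abs_real_inner_le_norm t ξ).trans (mul_le_mul_of_nonneg_left hξ hr)
  have hnorm : ‖t + g • ξ‖ ^ 2 ≤ ‖t‖ ^ 2 + 2 * g * inner ℝ t ξ + g ^ 2 * K ^ 2 := by
    rw [norm_add_sq_real, real_inner_smul_right, norm_smul, mul_pow, Real.norm_eq_abs, sq_abs]
    have : ‖ξ‖ ^ 2 ≤ K ^ 2 := by gcongr
    nlinarith [sq_nonneg g]
  have hsq' := sq_sqrt_one_add_norm_sq (t + g • ξ)
  have hW : lyapunov l t = Real.exp (l * (√(1 + ‖t‖ ^ 2) - 1)) - 1 := rfl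
  have hW' : lyapunov l (t + g • ξ) = Real.exp (l * (√(1 + ‖t + g • ξ‖ ^ 2) - 1)) - 1 := rfl
  set s := √(1 + ‖t‖ ^ 2) with hsdef
  set s' := √(1 + ‖t + g • ξ‖ ^ 2) with hsdef'
  set i := inner ℝ t ξ with hi
  set a := l * g / s * i with ha
  set b := l * g ^ 2 * K ^ 2 / (2 * s) with hb
  have hb0 : 0 ≤ b := by positivity
  have hble : b ≤ l * g ^ 2 * K ^ 2 / 2 := by
    rw [hb]; exact div_le_div_of_nonneg_left (by positivity) (by norm_num) (by linarith)
  have haabs : |a| ≤ l * g * K * (‖t‖ / s) := by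
    rw [ha, abs_mul, abs_of_nonneg (by positivity)]
    calc l * g / s * |i| ≤ l * g / s * (‖t‖ * K) := by gcongr
      _ = _ := by ring
  have hrs1 : ‖t‖ / s ≤ 1 := (div_le_one hs0).2 hrs
  have haabs' : |a| ≤ l * g * K :=
    haabs.trans (mul_le_of_le_one_right (by positivity) hrs1)
  have hz1 : |a + b| ≤ 1 := by
    refine (abs_add_le a b).trans ?_
    rw [abs_of_nonneg hb0]
    nlinarith [mul_nonneg hl.le (mul_nonneg (sq_nonneg g) (sq_nonneg K))]
  refine ⟨a + b, rfl, hz1, ?_, ?_⟩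
  · rw [← hs]
    have h1 : a ^ 2 ≤ (l * g * K * (‖t‖ / s)) ^ 2 := by
      rw [← sq_abs a]; gcongr
    have h2 : b ^ 2 ≤ (l * g ^ 2 * K ^ 2 / 2) ^ 2 := by gcongr
    have h3 : (a + b) ^ 2 ≤ 2 * a ^ 2 + 2 * b ^ 2 := by nlinarith [sq_nonneg (a - b)]
    have h4 : (l * g * K * (‖t‖ / s)) ^ 2 = l ^ 2 * g ^ 2 * K ^ 2 * (‖t‖ ^ 2 / s ^ 2) := by ring
    have h5 : (l * g ^ 2 * K ^ 2 / 2) ^ 2 = l ^ 2 * g ^ 4 * K ^ 4 / 4 := by ring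
    have h6 : 0 ≤ l ^ 2 * g ^ 4 * K ^ 4 := by positivity
    linarith
  · -- `√` is concave, so `s' - s ≤ (s'² - s²) / (2 s)`
    have h1 : l * (s' - s) ≤ a + b := by
      have h2 : (s' - s) * (2 * s) ≤ 2 * g * i + g ^ 2 * K ^ 2 := by
        nlinarith [sq_nonneg (s' - s)]
      have h3 : s' - s ≤ (2 * g * i + g ^ 2 * K ^ 2) / (2 * s) := by
        rwa [le_div_iff₀ (by positivity)]
      have h4 : a + b = l * ((2 * g * i + g ^ 2 * K ^ 2) / (2 * s)) := by
        rw [ha, hb]; field_simp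
      rw [h4]; gcongr
    have h2 : Real.exp (a + b) ≤ 1 + (a + b) + (a + b) ^ 2 := by
      have := (abs_le.1 (Real.abs_exp_sub_one_sub_id_le hz1)).2
      linarith
    have h3 : Real.exp (l * (s' - 1)) ≤ Real.exp (l * (s - 1)) * Real.exp (a + b) := by
      rw [← Real.exp_add]
      exact Real.exp_le_exp.2 (by linarith)
    have h4 := mul_le_mul_of_nonneg_left h2 (Real.exp_pos (l * (s - 1))).le
    rw [hW', hW]
    linarith

/-- Second-order expansion of the Lyapunov function along a step `g ξ`. -/
theorem exists_lyapunov_add_smul_le_linear {l G K : ℝ} (hl : 0 < l) (hK : 0 ≤ K)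
    (hlG : l * (G * K + G ^ 2 * K ^ 2) ≤ 1) :
    ∃ D : ℝ, 0 ≤ D ∧ ∀ g : ℝ, 0 ≤ g → g ≤ G → ∀ t ξ : E, ‖ξ‖ ≤ K →
      lyapunov l (t + g • ξ) ≤ lyapunov l t +
        (1 + lyapunov l t) * (l * g / √(1 + ‖t‖ ^ 2)) * inner ℝ t ξ
        + D * g ^ 2 * (1 + lyapunov l t) := by
  refine ⟨l * K ^ 2 + 2 * l ^ 2 * K ^ 2 + l ^ 2 * G ^ 2 * K ^ 4, by positivity,
    fun g hg hgG t ξ hξ => ?_⟩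
  have hlg : l * (g * K + g ^ 2 * K ^ 2) ≤ 1 := le_trans (by gcongr) hlG
  obtain ⟨z, hz, -, hz2, hW⟩ := exists_lyapunov_add_smul_le hl hg hlg (t := t) hξ
  have hs1 := one_le_sqrt_one_add_norm_sq t
  have hW0 := lyapunov_nonneg hl.le t
  set s := √(1 + ‖t‖ ^ 2)
  have hq : ‖t‖ ^ 2 / (1 + ‖t‖ ^ 2) ≤ 1 := by
    rw [div_le_one (by positivity)]; linarith
  have h1 : l * g ^ 2 * K ^ 2 / (2 * s) ≤ l * g ^ 2 * K ^ 2 :=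
    div_le_self (by positivity) (by linarith)
  have h2 : 2 * l ^ 2 * g ^ 2 * K ^ 2 * (‖t‖ ^ 2 / (1 + ‖t‖ ^ 2)) ≤ 2 * l ^ 2 * g ^ 2 * K ^ 2 :=
    mul_le_of_le_one_right (by positivity) hq
  have h3 : l ^ 2 * g ^ 4 * K ^ 4 ≤ l ^ 2 * G ^ 2 * K ^ 4 * g ^ 2 := by
    have : g ^ 2 ≤ G ^ 2 := by gcongr
    have := mul_le_mul_of_nonneg_left this (show 0 ≤ l ^ 2 * K ^ 4 * g ^ 2 by positivity)
    linarith
  have h4 : z + z ^ 2 ≤ l * g / s * inner ℝ t ξ +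
      (l * K ^ 2 + 2 * l ^ 2 * K ^ 2 + l ^ 2 * G ^ 2 * K ^ 4) * g ^ 2 := by
    linarith
  have h5 := mul_le_mul_of_nonneg_left h4 (show 0 ≤ 1 + lyapunov l t by linarith)
  linarith

/-- Second-order expansion of the square of the Lyapunov function along a step `g ξ`. The remainder
of order `g²` vanishes at `t = 0`. -/
theorem exists_sq_lyapunov_add_smul_le {l G K : ℝ} (hl : 0 < l) (hK : 0 ≤ K)
    (hlG : l * (G * K + G ^ 2 * K ^ 2) ≤ 1) :
    ∃ D : ℝ, 0 ≤ D ∧ ∀ g : ℝ, 0 ≤ g → g ≤ G → ∀ t ξ : E, ‖ξ‖ ≤ K →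
      lyapunov l (t + g • ξ) ^ 2 ≤ lyapunov l t ^ 2 +
        2 * lyapunov l t * ((1 + lyapunov l t) * (l * g / √(1 + ‖t‖ ^ 2))) * inner ℝ t ξ
        + D * g ^ 2 * (lyapunov l t + lyapunov l t ^ 2) + D * g ^ 4 := by
  refine ⟨2 * l * K ^ 2 + 12 * l ^ 2 * K ^ 2 * (2 / l + 2) + 12 * l ^ 2 * K ^ 4
    + 12 * l ^ 2 * K ^ 4 * G ^ 2, by positivity, fun g hg hgG t ξ hξ => ?_⟩
  have hlg : l * (g * K + g ^ 2 * K ^ 2) ≤ 1 := le_trans (by gcongr) hlG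
  obtain ⟨z, hz, hz1, hz2, hW⟩ := exists_lyapunov_add_smul_le hl hg hlg (t := t) hξ
  have hs1 := one_le_sqrt_one_add_norm_sq t
  have hs := sq_sqrt_one_add_norm_sq t
  have hW0 := lyapunov_nonneg hl.le t
  have hW0' := lyapunov_nonneg hl.le (t + g • ξ)
  have hsW := le_lyapunov l t
  rw [← hs] at hz2
  set s := √(1 + ‖t‖ ^ 2) with hsdef
  set W := lyapunov l t with hWdef
  set q := ‖t‖ ^ 2 / s ^ 2 with hq
  have hq0 : 0 ≤ q := by positivity
  have hq1 : q ≤ 1 := by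
    rw [hq, div_le_one (by positivity)]; linarith
  have hqW : q ≤ 2 / l * W := by
    have h1 : q ≤ 2 * (s - 1) := by
      rw [hq, div_le_iff₀ (by positivity)]
      linarith [mul_nonneg (sub_nonneg.2 hs1) (show 0 ≤ 2 * s ^ 2 - s - 1 by nlinarith only [hs1])]
    have h2 : s - 1 ≤ W / l := by rw [le_div_iff₀ hl]; linarith
    calc q ≤ 2 * (s - 1) := h1
      _ ≤ 2 * (W / l) := by linarith
      _ = 2 / l * W := by ring
  -- the square of the upper bound for the increment
  have h1 : lyapunov l (t + g • ξ) ^ 2 ≤ (W + (1 + W) * (z + z ^ 2)) ^ 2 := by gcongr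
  have h2 : (z + z ^ 2) ^ 2 ≤ 4 * z ^ 2 := by
    have : (1 + z) ^ 2 ≤ 4 := by
      obtain ⟨hz3, hz4⟩ := abs_le.1 hz1
      nlinarith only [hz3, hz4]
    calc (z + z ^ 2) ^ 2 = z ^ 2 * (1 + z) ^ 2 := by ring
      _ ≤ z ^ 2 * 4 := mul_le_mul_of_nonneg_left this (sq_nonneg z)
      _ = _ := by ring
  have h3 : (W + (1 + W) * (z + z ^ 2)) ^ 2 ≤
      W ^ 2 + 2 * W * (1 + W) * z + 6 * (1 + W) ^ 2 * z ^ 2 := by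
    have e1 := mul_le_mul_of_nonneg_left h2 (sq_nonneg (1 + W))
    have e2 : 2 * W * (1 + W) * z ^ 2 ≤ 2 * (1 + W) ^ 2 * z ^ 2 := by
      have : 0 ≤ (1 + W) * z ^ 2 := by positivity
      linarith
    linarith
  have h4 : 2 * W * (1 + W) * (l * g ^ 2 * K ^ 2 / (2 * s)) ≤
      2 * l * K ^ 2 * (g ^ 2 * (W + W ^ 2)) := by
    have : l * g ^ 2 * K ^ 2 / (2 * s) ≤ l * g ^ 2 * K ^ 2 :=
      div_le_self (by positivity) (by linarith)
    have := mul_le_mul_of_nonneg_left this (show 0 ≤ 2 * W * (1 + W) by positivity)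
    linarith
  have h5 : (1 + W) ^ 2 * q ≤ (2 / l + 2) * (W + W ^ 2) := by
    have e1 : W * q ≤ W := mul_le_of_le_one_right hW0 hq1
    have e2 : W ^ 2 * q ≤ W ^ 2 := mul_le_of_le_one_right (sq_nonneg W) hq1
    have e3 : 0 ≤ 2 / l * W ^ 2 := by positivity
    linarith [sq_nonneg W]
  have h6 : (1 + W) ^ 2 * g ^ 4 ≤ 2 * g ^ 4 + 2 * G ^ 2 * (g ^ 2 * (W + W ^ 2)) := by
    have e1 : (1 + W) ^ 2 ≤ 2 + 2 * W ^ 2 := by linarith [sq_nonneg (1 - W)]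
    have e2 : g ^ 2 ≤ G ^ 2 := by gcongr
    have e3 := mul_le_mul_of_nonneg_left e2 (show 0 ≤ 2 * (g ^ 2 * W ^ 2) by positivity)
    have e4 := mul_le_mul_of_nonneg_right e1 (show 0 ≤ g ^ 4 by positivity)
    have e5 : 0 ≤ 2 * G ^ 2 * (g ^ 2 * W) := by positivity
    linarith
  have h7 : 6 * (1 + W) ^ 2 * z ^ 2 ≤ 12 * l ^ 2 * K ^ 2 * (2 / l + 2) * (g ^ 2 * (W + W ^ 2))
      + 12 * l ^ 2 * K ^ 4 * g ^ 4 + 12 * l ^ 2 * K ^ 4 * G ^ 2 * (g ^ 2 * (W + W ^ 2)) := by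
    calc 6 * (1 + W) ^ 2 * z ^ 2
        ≤ 6 * (1 + W) ^ 2 * (2 * l ^ 2 * g ^ 2 * K ^ 2 * q + l ^ 2 * g ^ 4 * K ^ 4) := by gcongr
      _ = 12 * l ^ 2 * K ^ 2 * g ^ 2 * ((1 + W) ^ 2 * q)
            + 6 * l ^ 2 * K ^ 4 * ((1 + W) ^ 2 * g ^ 4) := by ring
      _ ≤ 12 * l ^ 2 * K ^ 2 * g ^ 2 * ((2 / l + 2) * (W + W ^ 2))
            + 6 * l ^ 2 * K ^ 4 * (2 * g ^ 4 + 2 * G ^ 2 * (g ^ 2 * (W + W ^ 2))) := by gcongr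
      _ = _ := by ring
  have h8 : 2 * W * (1 + W) * z = 2 * W * ((1 + W) * (l * g / s)) * inner ℝ t ξ
      + 2 * W * (1 + W) * (l * g ^ 2 * K ^ 2 / (2 * s)) := by rw [hz]; ring
  have h9 : 0 ≤ 2 * l * K ^ 2 := by positivity
  have h10 : 0 ≤ 12 * l ^ 2 * K ^ 2 * (2 / l + 2) := by positivity
  have h11 : 0 ≤ 12 * l ^ 2 * K ^ 4 := by positivity
  have h12 : 0 ≤ 12 * l ^ 2 * K ^ 4 * G ^ 2 := by positivity
  have h13 : 0 ≤ g ^ 2 * (W + W ^ 2) := by positivity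
  have h14 : 0 ≤ g ^ 4 := by positivity
  refine (h1.trans h3).trans ?_
  rw [h8, mul_assoc _ (g ^ 2) (W + W ^ 2)]
  generalize g ^ 2 * (W + W ^ 2) = y at *
  generalize g ^ 4 = x at *
  generalize 12 * l ^ 2 * K ^ 4 * G ^ 2 = k₄ at *
  generalize 12 * l ^ 2 * K ^ 4 = k₃ at *
  generalize 12 * l ^ 2 * K ^ 2 * (2 / l + 2) = k₂ at *
  generalize 2 * l * K ^ 2 = k₁ at *
  have := mul_nonneg h9 h14
  have := mul_nonneg h10 h14
  have := mul_nonneg h12 h14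
  have := mul_nonneg h11 h13
  linarith

end Lyapunov

/-! ### Step sizes and a deterministic recursion -/

section Recursion

theorem stepSize_nonneg {γ : ℝ} (hγ : 0 ≤ γ) (α : ℝ) (n : ℕ) : 0 ≤ stepSize γ α n :=
  mul_nonneg hγ (by positivity)

theorem stepSize_le {γ α : ℝ} (hγ : 0 ≤ γ) (hα : 0 ≤ α) {n : ℕ} (hn : 1 ≤ n) :
    stepSize γ α n ≤ γ :=
  mul_le_of_le_one_right hγ
    (Real.rpow_le_one_of_one_le_of_nonpos (by exact_mod_cast hn) (by linarith))

theorem tendsto_stepSize {γ α : ℝ} (hα : 0 < α) : Tendsto (stepSize γ α) atTop (𝓝 0) := by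
  have := ((tendsto_rpow_neg_atTop hα).comp tendsto_natCast_atTop_atTop).const_mul γ
  rw [mul_zero] at this
  exact this

theorem half_lt_of_robbinsMonro {γ α : ℝ} (hγ : 0 < γ)
    (h : RobbinsMonro (stepSize γ α)) : 1 / 2 < α := by
  have h2 := (summable_nat_add_iff (f := fun n : ℕ => stepSize γ α n ^ 2) 1).1 h.2
  have h3 : Summable fun n : ℕ => (n : ℝ) ^ (-α * 2) := by
    refine (h2.mul_left (γ ^ 2)⁻¹).congr fun n => ?_
    rw [stepSize, mul_pow, Real.rpow_mul (Nat.cast_nonneg n), Real.rpow_two]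
    field_simp
  rw [Real.summable_nat_rpow] at h3
  linarith

/-- A recursion with contraction `1 - c γ_n` and forcing `γ_n^{q+1}` decays like `γ_n^q`: the
rescaled sequence `a_n n^{q α}` stays bounded, because `α < 1` makes the relative increment of the
weight, of order `1 / n`, negligible against `γ_n`. -/
theorem exists_forall_le_of_recursion {γ α c D : ℝ} (hγ : 0 < γ) (hα0 : 0 < α) (hα1 : α < 1)
    (hc : 0 < c) (q : ℕ) {a : ℕ → ℝ} (ha0 : ∀ n, 0 ≤ a n)
    (ha : ∀ n, 1 ≤ n → a (n + 1) ≤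
      (1 - c * stepSize γ α n + D * stepSize γ α n ^ 2) * a n + D * stepSize γ α n ^ (q + 1)) :
    ∃ B : ℝ, 0 ≤ B ∧ ∀ n, 1 ≤ n → a n ≤ B * stepSize γ α n ^ q := by
  have hg : ∀ n : ℕ, 1 ≤ n → 0 < stepSize γ α n := fun n hn =>
    mul_pos hγ (Real.rpow_pos_of_pos (by exact_mod_cast hn) _)
  -- the relative decrease of the step size is of order `1 / n`
  have hratio : ∀ n : ℕ, 1 ≤ n →
      stepSize γ α n ≤ (1 + 1 / (n : ℝ)) * stepSize γ α (n + 1) := by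
    intro n hn
    have hn0 : (0 : ℝ) < n := by exact_mod_cast hn
    have h1 : (n : ℝ) ^ (-α) = (1 + 1 / (n : ℝ)) ^ α * ((n : ℝ) + 1) ^ (-α) := by
      rw [show (n : ℝ) + 1 = (1 + 1 / (n : ℝ)) * n by field_simp,
        Real.mul_rpow (by positivity) hn0.le, ← mul_assoc, ← Real.rpow_add (by positivity)]
      simp
    have h2 : (1 + 1 / (n : ℝ)) ^ α ≤ 1 + 1 / (n : ℝ) := by
      have h3 : (1 : ℝ) ≤ 1 + 1 / (n : ℝ) := by
        have : (0 : ℝ) ≤ 1 / n := by positivity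
        linarith
      simpa using Real.rpow_le_rpow_of_exponent_le h3 hα1.le
    rw [stepSize, stepSize, h1]
    push_cast
    calc γ * ((1 + 1 / (n : ℝ)) ^ α * ((n : ℝ) + 1) ^ (-α))
        ≤ γ * ((1 + 1 / (n : ℝ)) * ((n : ℝ) + 1) ^ (-α)) := by gcongr
      _ = _ := by ring
  have hmain : ∀ᶠ n : ℕ in atTop, 1 ≤ n ∧ c * stepSize γ α n ≤ 1 ∧
      (1 + 1 / (n : ℝ)) ^ q ≤ 2 ∧
      (1 + 1 / (n : ℝ)) ^ q * (1 - c * stepSize γ α n + D * stepSize γ α n ^ 2) ≤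
        1 - c / 4 * stepSize γ α n := by
    have hlim0 := tendsto_stepSize (γ := γ) hα0
    -- `1 / n` is negligible against the step size
    have hlim1 : ∀ δ : ℝ, 0 < δ → ∀ᶠ n : ℕ in atTop, 1 / (n : ℝ) ≤ δ * stepSize γ α n := by
      intro δ hδ
      have h := (tendsto_rpow_neg_atTop (sub_pos.2 hα1)).comp tendsto_natCast_atTop_atTop
      filter_upwards [h.eventually (ge_mem_nhds (show 0 < δ * γ by positivity)),
        eventually_ge_atTop 1] with n hn hn1
      have hn0 : (0 : ℝ) < n := by exact_mod_cast hn1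
      have e : 1 / (n : ℝ) = (n : ℝ) ^ (-(1 - α)) * (n : ℝ) ^ (-α) := by
        rw [← Real.rpow_add hn0, one_div, ← Real.rpow_neg_one]; congr 1; ring
      rw [e, stepSize, ← mul_assoc]
      exact mul_le_mul_of_nonneg_right hn (by positivity)
    have hev1 : ∀ᶠ n : ℕ in atTop, c * stepSize γ α n ≤ 1 := by
      have := hlim0.const_mul c
      rw [mul_zero] at this
      exact this.eventually (ge_mem_nhds one_pos)
    have hev2 : ∀ᶠ n : ℕ in atTop, D * stepSize γ α n ≤ c / 4 := by
      have := hlim0.const_mul D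
      rw [mul_zero] at this
      exact this.eventually (ge_mem_nhds (by positivity))
    filter_upwards [hev1, hev2, hlim1 (c / (8 * (q + 1))) (by positivity),
      eventually_ge_atTop 1] with n h1 h2 h3 hn1
    have hgn := hg n hn1
    set g := stepSize γ α n
    set x : ℝ := q * (1 / (n : ℝ)) with hx
    have hx0 : 0 ≤ x := by positivity
    have hxg : x ≤ c / 8 * g := by
      calc x ≤ q * (c / (8 * (q + 1)) * g) := by rw [hx]; gcongr
        _ = c / 8 * g * (q / (q + 1)) := by field_simp
        _ ≤ c / 8 * g := by
          apply mul_le_of_le_one_right (by positivity)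
          rw [div_le_one (by positivity)]; linarith
    have hw : (1 + 1 / (n : ℝ)) ^ q ≤ 1 + 2 * x := by
      have e1 : (1 + 1 / (n : ℝ)) ^ q ≤ Real.exp x := by
        rw [hx, Real.exp_nat_mul]
        gcongr
        linarith [Real.add_one_le_exp (1 / (n : ℝ))]
      have e2 := (abs_le.1 (Real.abs_exp_sub_one_sub_id_le (x := x)
        (by rw [abs_of_nonneg hx0]; linarith))).2
      nlinarith
    have hw0 : 0 ≤ (1 + 1 / (n : ℝ)) ^ q := by positivity
    refine ⟨hn1, h1, by linarith, ?_⟩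
    have h4 : 1 - c * g + D * g ^ 2 ≤ 1 - 3 / 4 * (c * g) := by nlinarith
    have h5 : (1 + 1 / (n : ℝ)) ^ q ≤ 1 + 1 / 4 * (c * g) := by linarith
    have h6 : 0 ≤ c * g := by positivity
    calc _ ≤ (1 + 1 / (n : ℝ)) ^ q * (1 - 3 / 4 * (c * g)) := by gcongr
      _ ≤ (1 + 1 / 4 * (c * g)) * (1 - 3 / 4 * (c * g)) := by
          gcongr
          linarith
      _ ≤ 1 - c / 4 * g := by nlinarith
  obtain ⟨N, hN⟩ := eventually_atTop.1 hmain
  set D' := max D 0 with hD'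
  have hD'0 : 0 ≤ D' := le_max_right _ _
  -- beyond `N` the bound propagates once `B` dominates the forcing
  have hstep : ∀ B : ℝ, 8 * D' / c ≤ B → ∀ n, N ≤ n → a n ≤ B * stepSize γ α n ^ q →
      a (n + 1) ≤ B * stepSize γ α (n + 1) ^ q := by
    intro B hB n hn han
    obtain ⟨hn1, hcg, hw2, hw⟩ := hN n hn
    have hgn := hg n hn1
    have hgn' := hg (n + 1) (by omega)
    have hB0 : 0 ≤ B := le_trans (by positivity) hB
    have hDB : 2 * D' ≤ c / 4 * B := by
      rw [div_le_iff₀ hc] at hB; linarith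
    have hpow : stepSize γ α n ^ q ≤ (1 + 1 / (n : ℝ)) ^ q * stepSize γ α (n + 1) ^ q := by
      rw [← mul_pow]; exact pow_le_pow_left₀ hgn.le (hratio n hn1) q
    have hw0 : 1 ≤ (1 + 1 / (n : ℝ)) ^ q := one_le_pow₀ (by simp)
    set w := (1 + 1 / (n : ℝ)) ^ q
    set g := stepSize γ α n
    set g' := stepSize γ α (n + 1)
    have h0 := ha n hn1
    have hgq' : 0 < g' ^ q := pow_pos hgn' q
    have h1 : D * g ^ (q + 1) ≤ D' * (g * (w * g' ^ q)) := by
      rw [pow_succ, mul_comm (g ^ q)]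
      gcongr
      exact le_max_left _ _
    have h2 : w * (D' * g) ≤ c / 4 * B * g := by
      nlinarith [mul_nonneg (mul_nonneg hD'0 hgn.le) (sub_nonneg.2 hw2)]
    by_cases hpos : 0 ≤ 1 - c * g + D * g ^ 2
    · calc a (n + 1) ≤ (1 - c * g + D * g ^ 2) * a n + D * g ^ (q + 1) := h0
        _ ≤ (1 - c * g + D * g ^ 2) * (B * (w * g' ^ q)) + D' * (g * (w * g' ^ q)) := by
            gcongr
            exact han.trans (by gcongr)
        _ = (B * (w * (1 - c * g + D * g ^ 2)) + w * (D' * g)) * g' ^ q := by ring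
        _ ≤ (B * (1 - c / 4 * g) + c / 4 * B * g) * g' ^ q := by gcongr
        _ = B * g' ^ q := by ring
    · calc a (n + 1) ≤ (1 - c * g + D * g ^ 2) * a n + D * g ^ (q + 1) := h0
        _ ≤ 0 + D' * (g * (w * g' ^ q)) :=
            add_le_add (mul_nonpos_of_nonpos_of_nonneg (not_le.1 hpos).le (ha0 n)) h1
        _ = (w * (D' * g)) * g' ^ q := by ring
        _ ≤ (c / 4 * B * g) * g' ^ q := by gcongr
        _ ≤ B * g' ^ q := by
            gcongr
            nlinarith
  -- the finitely many terms up to `N` are absorbed by the constant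
  set B : ℝ := 8 * D' / c + ∑ k ∈ Finset.range (N + 1), a k / stepSize γ α k ^ q with hB
  have hterm : ∀ k, 0 ≤ a k / stepSize γ α k ^ q := fun k =>
    div_nonneg (ha0 k) (pow_nonneg (stepSize_nonneg hγ.le α k) q)
  have hB1 : 8 * D' / c ≤ B := le_add_of_nonneg_right (Finset.sum_nonneg fun k _ => hterm k)
  refine ⟨B, le_trans (by positivity) hB1, fun n hn => ?_⟩
  have hsmall : ∀ n, 1 ≤ n → n ≤ N → a n ≤ B * stepSize γ α n ^ q := by
    intro n hn hnN
    rw [← div_le_iff₀ (pow_pos (hg n hn) q)]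
    have h1 := Finset.single_le_sum (f := fun k => a k / stepSize γ α k ^ q)
      (fun k _ => hterm k) (Finset.mem_range.2 (Nat.lt_succ_of_le hnN))
    have h2 : 0 ≤ 8 * D' / c := by positivity
    linarith
  rcases le_total n N with h | h
  · exact hsmall n hn h
  · have hN1 : 1 ≤ N := (hN N le_rfl).1
    induction n, h using Nat.le_induction with
    | base => exact hsmall N hN1 le_rfl
    | succ n hNn ih => exact hstep B hB1 n hNn (ih (hN1.trans hNn))

end Recursion

/-! ### The mean drift of the error -/

section Model

variable {H : Type*} [NormedAddCommGroup H] [InnerProductSpace ℝ H] {d : ℕ}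

/-- The direction of an update in terms of the error `t = b - β` and the noise `u`: the negative
stochastic gradient of `t ↦ E(‖U - Xᵀ t‖ - ‖U‖)`. -/
def errorDirection (x : EuclideanSpace ℝ (Fin d)) (u : H) (t : HPow H d) : HPow H d :=
  scaleH x (direction (u - dotH x t))

theorem norm_sum_smul_sq (a : Fin d → ℝ) (t : Fin d → H) :
    ‖∑ i, a i • t i‖ ^ 2 = ∑ i, ∑ j, a i * a j * inner ℝ (t i) (t j) := by
  rw [← real_inner_self_eq_norm_sq, sum_inner]
  refine Finset.sum_congr rfl fun i _ => ?_
  rw [inner_sum]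
  refine Finset.sum_congr rfl fun j _ => ?_
  rw [real_inner_smul_left, real_inner_smul_right, mul_assoc]

theorem dotH_sub (x : EuclideanSpace ℝ (Fin d)) (φ ψ : HPow H d) :
    dotH x (φ - ψ) = dotH x φ - dotH x ψ := by
  simp [dotH, smul_sub, Finset.sum_sub_distrib]

theorem inner_scaleH (x : EuclideanSpace ℝ (Fin d)) (φ : HPow H d) (y : H) :
    inner ℝ φ (scaleH x y) = inner ℝ (dotH x φ) y := by
  simp [dotH, scaleH, PiLp.inner_apply, sum_inner, real_inner_smul_left, real_inner_smul_right]

theorem norm_scaleH (x : EuclideanSpace ℝ (Fin d)) (y : H) : ‖scaleH x y‖ = ‖x‖ * ‖y‖ := by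
  rw [← sq_eq_sq₀ (norm_nonneg _) (by positivity), mul_pow, EuclideanSpace.norm_sq_eq,
    PiLp.norm_sq_eq_of_L2, Finset.sum_mul]
  simp [scaleH, norm_smul, mul_pow]

theorem norm_dotH_le (x : EuclideanSpace ℝ (Fin d)) (φ : HPow H d) :
    ‖dotH x φ‖ ≤ ‖x‖ * ‖φ‖ := by
  have h : ‖dotH x φ‖ * ‖dotH x φ‖ ≤ ‖φ‖ * (‖x‖ * ‖dotH x φ‖) := by
    rw [← real_inner_self_eq_norm_mul_norm, ← norm_scaleH, ← inner_scaleH]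
    exact real_inner_le_norm _ _
  by_cases h0 : dotH x φ = 0
  · rw [h0, norm_zero]; positivity
  · have := norm_pos_iff.2 h0
    nlinarith

theorem norm_errorDirection_le (x : EuclideanSpace ℝ (Fin d)) (u : H) (t : HPow H d) :
    ‖errorDirection x u t‖ ≤ ‖x‖ := by
  rw [errorDirection, norm_scaleH]
  exact mul_le_of_le_one_right (norm_nonneg x) (norm_direction_le _)

theorem sgdStep_sub (s : ℝ) (x : EuclideanSpace ℝ (Fin d)) (u : H) (b β : HPow H d) :
    sgdStep s x (dotH x β + u) b - β = (b - β) + s • errorDirection x u (b - β) := by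
  have h : dotH x β + u - dotH x b = u - dotH x (b - β) := by rw [dotH_sub]; abel
  have h2 : ∀ w : H, ‖w‖⁻¹ • scaleH x w = scaleH x (direction w) := by
    intro w
    ext j
    simp only [scaleH, direction, PiLp.smul_apply]
    exact smul_comm _ _ _
  rw [sgdStep, h, h2, errorDirection]
  abel

theorem continuous_dotH :
    Continuous fun p : EuclideanSpace ℝ (Fin d) × HPow H d => dotH p.1 p.2 := by
  unfold dotH
  fun_prop

theorem continuous_scaleH :
    Continuous fun p : EuclideanSpace ℝ (Fin d) × H => scaleH p.1 p.2 := by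
  unfold scaleH
  fun_prop

/-- `E ‖Xᵀ t‖² ≥ λ_min(Σ) ‖t‖²`, by diagonalizing `Σ`. -/
theorem exists_forall_integral_norm_dotH_sq_ge {Ω : Type*} [MeasurableSpace Ω] {P : Measure Ω}
    [IsFiniteMeasure P] {X : Ω → EuclideanSpace ℝ (Fin d)} (hX : Measurable X)
    (hXbdd : AEBounded P X) (hcov : WellConditioned P X) :
    ∃ c : ℝ, 0 < c ∧ ∀ t : HPow H d, c * ‖t‖ ^ 2 ≤ ∫ ω, ‖dotH (X ω) t‖ ^ 2 ∂P := by
  obtain ⟨C, hC, hev⟩ := hcov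
  obtain ⟨K, hK⟩ := hXbdd
  refine ⟨1 / C, by positivity, fun t => ?_⟩
  set hA := secondMoment_isHermitian P X
  set V : Matrix (Fin d) (Fin d) ℝ := hA.eigenvectorUnitary.1 with hV
  have hcoord : ∀ i, ∀ᵐ ω ∂P, ‖X ω i‖ ≤ K := fun i => by
    filter_upwards [hK] with ω hω using (PiLp.norm_apply_le (X ω) i).trans hω
  have hint : ∀ i j, Integrable (fun ω => X ω i * X ω j) P := by
    intro i j
    refine Integrable.of_bound (C := K * K) (by fun_prop) ?_
    filter_upwards [hcoord i, hcoord j] with ω hi hj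
    rw [norm_mul]
    exact mul_le_mul hi hj (norm_nonneg _) ((norm_nonneg _).trans hi)
  have h1 : ∫ ω, ‖dotH (X ω) t‖ ^ 2 ∂P =
      ∑ i, ∑ j, secondMoment P X i j * inner ℝ (t i) (t j) := by
    simp only [dotH, norm_sum_smul_sq]
    rw [integral_finsetSum _ fun i _ => integrable_finsetSum _ fun j _ => (hint i j).mul_const _]
    refine Finset.sum_congr rfl fun i _ => ?_
    rw [integral_finsetSum _ fun j _ => (hint i j).mul_const _]
    refine Finset.sum_congr rfl fun j _ => ?_
    rw [integral_mul_const]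
    rfl
  -- the quadratic form of `V diag(μ) Vᵀ` on `H`-valued vectors
  have hquad : ∀ μ : Fin d → ℝ,
      ∑ i, ∑ j, (∑ k, V i k * μ k * V j k) * inner ℝ (t i) (t j) =
        ∑ k, μ k * ‖∑ i, V i k • t i‖ ^ 2 := by
    intro μ
    simp only [norm_sum_smul_sq, Finset.sum_mul, Finset.mul_sum]
    rw [Finset.sum_comm (f := fun k i => ∑ j, μ k * (V i k * V j k * inner ℝ (t i) (t j)))]
    refine Finset.sum_congr rfl fun i _ => ?_
    rw [Finset.sum_comm]
    exact Finset.sum_congr rfl fun k _ => Finset.sum_congr rfl fun j _ => by ring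
  have hspec : ∀ i j, secondMoment P X i j = ∑ k, V i k * hA.eigenvalues k * V j k := by
    intro i j
    conv_lhs => rw [hA.spectral_theorem]
    simp [Unitary.conjStarAlgAut_apply, Matrix.mul_apply, Matrix.diagonal_apply, hV,
      Matrix.star_apply]
  have hunit : ∀ i j, ∑ k, V i k * 1 * V j k = if i = j then 1 else 0 := by
    intro i j
    have h := congrFun (congrFun (Unitary.coe_mul_star_self hA.eigenvectorUnitary) i) j
    rw [Matrix.mul_apply, Matrix.one_apply] at h
    rw [← h]
    simp [hV, Matrix.star_apply]
  have h2 : ‖t‖ ^ 2 = ∑ k, ‖∑ i, V i k • t i‖ ^ 2 := by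
    have := hquad fun _ => 1
    simp only [hunit, ite_mul, one_mul, zero_mul, Finset.sum_ite_eq, Finset.mem_univ, if_true,
      real_inner_self_eq_norm_sq] at this
    rw [← this, PiLp.norm_sq_eq_of_L2]
  rw [h1, h2, Finset.mul_sum]
  simp only [hspec]
  rw [hquad]
  exact Finset.sum_le_sum fun k _ => mul_le_mul_of_nonneg_right (hev k).1 (sq_nonneg _)

variable [MeasurableSpace H] [BorelSpace H] [SecondCountableTopology H]

theorem measurable_errorDirection :
    Measurable fun p : (EuclideanSpace ℝ (Fin d) × H) × HPow H d =>
      errorDirection p.1.1 p.1.2 p.2 := by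
  have h1 : Measurable fun p : (EuclideanSpace ℝ (Fin d) × H) × HPow H d => dotH p.1.1 p.2 :=
    continuous_dotH.measurable.comp (by fun_prop :
      Measurable fun p : (EuclideanSpace ℝ (Fin d) × H) × HPow H d => (p.1.1, p.2))
  have h2 : Measurable fun p : (EuclideanSpace ℝ (Fin d) × H) × HPow H d =>
      direction (p.1.2 - dotH p.1.1 p.2) :=
    measurable_direction.comp ((measurable_snd.comp measurable_fst).sub h1)
  exact continuous_scaleH.measurable.comp ((measurable_fst.comp measurable_fst).prodMk h2)

/-- The mean drift of the error: the coercivity of the median functional of `U`, applied at `Xᵀ t`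
and averaged over `X`. -/
theorem exists_forall_integral_inner_errorDirection_le {ρ : Measure (EuclideanSpace ℝ (Fin d))}
    [IsProbabilityMeasure ρ] {μ : Measure H} [IsProbabilityMeasure μ] {K c₁ c₂ : ℝ}
    (hc₁ : 0 < c₁) (hc₂ : 0 < c₂) (hK : ∀ᵐ x ∂ρ, ‖x‖ ≤ K)
    (hρ : ∀ t : HPow H d, c₁ * ‖t‖ ^ 2 ≤ ∫ x, ‖dotH x t‖ ^ 2 ∂ρ)
    (hμ : ∀ h : H, ∫ u, inner ℝ h (direction (u - h)) ∂μ ≤ -(c₂ * ‖h‖ ^ 2 / (1 + ‖h‖))) :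
    ∃ c : ℝ, 0 < c ∧ ∀ t : HPow H d,
      ∫ z, inner ℝ t (errorDirection z.1 z.2 t) ∂(ρ.prod μ) ≤ -(c * (‖t‖ ^ 2 / (1 + ‖t‖))) := by
  set L := max K 1 with hL
  have hL1 : 1 ≤ L := le_max_right _ _
  refine ⟨c₁ * c₂ / L, by positivity, fun t => ?_⟩
  have hm : Measurable fun z : EuclideanSpace ℝ (Fin d) × H => errorDirection z.1 z.2 t :=
    measurable_errorDirection.comp (measurable_id.prodMk measurable_const)
  have hKL : ∀ᵐ x ∂ρ, ‖x‖ ≤ L := hK.mono fun x hx => hx.trans (le_max_left _ _)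
  have hint : Integrable (fun z => inner ℝ t (errorDirection z.1 z.2 t)) (ρ.prod μ) := by
    refine Integrable.of_bound (C := ‖t‖ * L) (by fun_prop) ?_
    filter_upwards [Measure.quasiMeasurePreserving_fst.ae hKL] with z hz
    exact (norm_inner_le_norm _ _).trans
      (mul_le_mul_of_nonneg_left ((norm_errorDirection_le _ _ _).trans hz) (norm_nonneg t))
  have hdot : Measurable fun x : EuclideanSpace ℝ (Fin d) => dotH x t :=
    continuous_dotH.measurable.comp (measurable_id.prodMk measurable_const)
  have hint2 : Integrable (fun x => ‖dotH x t‖ ^ 2) ρ := by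
    refine Integrable.of_bound (C := (L * ‖t‖) ^ 2) (by fun_prop) ?_
    filter_upwards [hKL] with x hx
    rw [Real.norm_eq_abs, abs_of_nonneg (by positivity)]
    gcongr
    exact (norm_dotH_le x t).trans (by gcongr)
  have ht := norm_nonneg t
  rw [integral_prod _ hint]
  calc ∫ x, ∫ u, inner ℝ t (errorDirection x u t) ∂μ ∂ρ
      ≤ ∫ x, -(c₂ / (L * (1 + ‖t‖))) * ‖dotH x t‖ ^ 2 ∂ρ := by
        refine integral_mono_ae hint.integral_prod_left (hint2.const_mul _) ?_
        filter_upwards [hKL] with x hx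
        simp only [errorDirection, inner_scaleH]
        refine (hμ (dotH x t)).trans ?_
        rw [neg_mul, neg_le_neg_iff, div_mul_eq_mul_div]
        have h1 : ‖dotH x t‖ ≤ L * ‖t‖ := (norm_dotH_le x t).trans (by gcongr)
        refine div_le_div_of_nonneg_left (by positivity) (by positivity) ?_
        linarith
    _ = -(c₂ / (L * (1 + ‖t‖))) * ∫ x, ‖dotH x t‖ ^ 2 ∂ρ := integral_const_mul _ _
    _ ≤ -(c₂ / (L * (1 + ‖t‖))) * (c₁ * ‖t‖ ^ 2) :=
        mul_le_mul_of_nonpos_left (hρ t) (neg_nonpos.2 (by positivity))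
    _ = -(c₁ * c₂ / L * (‖t‖ ^ 2 / (1 + ‖t‖))) := by field_simp

end Model

/-! ### Independence of the iterates from the next observation -/

section Independence

variable {Ω : Type*} [MeasurableSpace Ω] {P : Measure Ω} [IsProbabilityMeasure P]

theorem indepFun_prodMk_of_indepFun {A B C : Type*} [MeasurableSpace A] [MeasurableSpace B]
    [MeasurableSpace C] {f : Ω → A} {g : Ω → B} {h : Ω → C} (hf : Measurable f)
    (hg : Measurable g) (hh : Measurable h) (h1 : IndepFun f (fun ω => (g ω, h ω)) P)
    (h2 : IndepFun g h P) : IndepFun (fun ω => (f ω, g ω)) h P := by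
  have hgh := hg.prodMk hh
  have e1 := (indepFun_iff_map_prod_eq_prod_map_map hf.aemeasurable hgh.aemeasurable).1 h1
  have e2 := (indepFun_iff_map_prod_eq_prod_map_map hg.aemeasurable hh.aemeasurable).1 h2
  have h3 : IndepFun f g P := h1.comp measurable_id measurable_fst
  have e3 := (indepFun_iff_map_prod_eq_prod_map_map hf.aemeasurable hg.aemeasurable).1 h3
  have : IsProbabilityMeasure (P.map f) := Measure.isProbabilityMeasure_map hf.aemeasurable
  have : IsProbabilityMeasure (P.map g) := Measure.isProbabilityMeasure_map hg.aemeasurable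
  have : IsProbabilityMeasure (P.map h) := Measure.isProbabilityMeasure_map hh.aemeasurable
  rw [indepFun_iff_map_prod_eq_prod_map_map (hf.prodMk hg).aemeasurable hh.aemeasurable, e3,
    ← MeasurableEquiv.prodAssoc.map_measurableEquiv_injective.eq_iff, Measure.prodAssoc_prod, ← e2,
    ← e1, Measure.map_map MeasurableEquiv.prodAssoc.measurable ((hf.prodMk hg).prodMk hh)]
  rfl

variable {H : Type*} [NormedAddCommGroup H] [InnerProductSpace ℝ H] [MeasurableSpace H]
  [BorelSpace H] [SecondCountableTopology H] {d : ℕ}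

/-- The iterate `β_n` is a measurable function of the initial value and the observations
`2, …, n`. This holds for an arbitrary `σ`-algebra on `Ω`, hence also gives adaptedness. -/
theorem measurable_sgdIterate {Ω : Type*} [MeasurableSpace Ω] (γ α : ℝ)
    {X : ℕ → Ω → EuclideanSpace ℝ (Fin d)} {Y : ℕ → Ω → H} {b₁ : Ω → HPow H d}
    (hb : Measurable b₁) (n : ℕ) (hX : ∀ i < n, Measurable (X (i + 2)))
    (hY : ∀ i < n, Measurable (Y (i + 2))) : Measurable (sgdIterate γ α X Y b₁ (n + 1)) := by
  induction n with
  | zero => exact hb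
  | succ n ih =>
    have ih' := ih (fun i hi => hX i (by omega)) (fun i hi => hY i (by omega))
    have hx := hX n (by omega)
    have hdot : Measurable fun ω => dotH (X (n + 2) ω) (sgdIterate γ α X Y b₁ (n + 1) ω) :=
      continuous_dotH.measurable.comp (hx.prodMk ih')
    have hw := (hY n (by omega)).sub hdot
    have hsc := continuous_scaleH.measurable.comp (hx.prodMk hw)
    exact ih'.add ((hw.norm.inv.smul hsc).const_smul (stepSize γ α (n + 1)))

/-- The iterate `β_{n+1}` is independent of the next observation. -/
theorem indepFun_sgdIterate (γ α : ℝ) {β : HPow H d} {X : ℕ → Ω → EuclideanSpace ℝ (Fin d)}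
    {Y U : ℕ → Ω → H} (hsample : IsSample P β X Y U) {b₁ : Ω → HPow H d} (hb₁ : Measurable b₁)
    (hb₁indep : IndepFun b₁ (fun ω (i : ℕ) => (X (i + 2) ω, U (i + 2) ω)) P) (n : ℕ) :
    IndepFun (sgdIterate γ α X Y b₁ (n + 1)) (fun ω => (X (n + 2) ω, U (n + 2) ω)) P := by
  let Z : ℕ → Ω → EuclideanSpace ℝ (Fin d) × H := fun i ω => (X (i + 2) ω, U (i + 2) ω)
  have hZ : ∀ i, Measurable (Z i) := fun i =>
    (hsample.measurable_X _ (by omega)).prodMk (hsample.measurable_U _ (by omega))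
  have hZind : iIndepFun Z P :=
    hsample.indep.precomp (g := fun i : ℕ => i + 1) (add_left_injective 1)
  let G : Ω → (Finset.range n → EuclideanSpace ℝ (Fin d) × H) := fun ω i => Z i ω
  have hG : Measurable G := measurable_pi_lambda _ fun i => hZ i
  have h2 : IndepFun G (Z n) P := by
    have h := hZind.indepFun_finset (Finset.range n) {n} (by simp) hZ
    exact h.comp measurable_id (measurable_pi_apply (⟨n, by simp⟩ : ({n} : Finset ℕ)))
  have h1 : IndepFun b₁ (fun ω => (G ω, Z n ω)) P := by
    refine hb₁indep.comp (φ := id)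
      (ψ := fun z : ℕ → EuclideanSpace ℝ (Fin d) × H =>
        ((fun i : Finset.range n => z i), z n)) measurable_id ?_
    fun_prop
  have h3 := indepFun_prodMk_of_indepFun hb₁ hG (hZ n) h1 h2
  rw [IndepFun_iff_Indep] at h3 ⊢
  refine indep_of_indep_of_le_left h3 (Measurable.comap_le ?_)
  have hF := comap_measurable (m := Prod.instMeasurableSpace) (fun ω => (b₁ ω, G ω))
  have hZi : ∀ i < n, Measurable[MeasurableSpace.comap (fun ω => (b₁ ω, G ω)) 
      Prod.instMeasurableSpace] (Z i) := fun i hi =>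
    (measurable_pi_apply (⟨i, Finset.mem_range.2 hi⟩ : Finset.range n)).comp
      (measurable_snd.comp hF)
  refine @measurable_sgdIterate H _ _ _ _ _ d Ω
    (MeasurableSpace.comap (fun ω => (b₁ ω, G ω)) Prod.instMeasurableSpace) γ α X Y b₁
    (measurable_fst.comp hF) n (fun i hi => measurable_fst.comp (hZi i hi)) fun i hi => ?_
  have hY : Y (i + 2) = fun ω => dotH (Z i ω).1 β + (Z i ω).2 :=
    funext (hsample.model (i + 2) (by omega))
  rw [hY]
  have hd : Measurable fun z : EuclideanSpace ℝ (Fin d) × H => dotH z.1 β + z.2 :=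
    (continuous_dotH.measurable.comp (measurable_fst.prodMk measurable_const)).add measurable_snd
  exact hd.comp (hZi i hi)

end Independence

/-! ### Recursions for the moments of the Lyapunov function -/

section Moments

variable {Ω : Type*} [MeasurableSpace Ω] {P : Measure Ω} [IsProbabilityMeasure P]
theorem integrable_comp_of_aeBounded {E : Type*} [NormedAddCommGroup E] [MeasurableSpace E]
    [BorelSpace E] [SecondCountableTopology E] {T : Ω → E} (hT : Measurable T)
    (hTbdd : AEBounded P T) {f : E → ℝ} (hf : Continuous f)
    (hbound : ∀ R : ℝ, ∃ B : ℝ, ∀ t, ‖t‖ ≤ R → ‖f t‖ ≤ B) :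
    Integrable (fun ω => f (T ω)) P := by
  obtain ⟨R, hR⟩ := hTbdd
  obtain ⟨B, hB⟩ := hbound R
  exact Integrable.of_bound (C := B) (hf.measurable.comp hT).aestronglyMeasurable
    (hR.mono fun ω hω => hB _ hω)

theorem exists_forall_norm_lyapunov_le {E : Type*} [NormedAddCommGroup E] {l : ℝ} (hl : 0 ≤ l)
    (R : ℝ) : ∃ B : ℝ, 0 ≤ B ∧ ∀ t : E, ‖t‖ ≤ R → ‖lyapunov l t‖ ≤ B := by
  refine ⟨|Real.exp (l * (√(1 + R ^ 2) - 1)) - 1|, abs_nonneg _, fun t ht => ?_⟩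
  rw [Real.norm_of_nonneg (lyapunov_nonneg hl t)]
  exact (lyapunov_le_of_norm_le hl ht).trans (le_abs_self _)

theorem integrable_lyapunov_pow {E : Type*} [NormedAddCommGroup E] [MeasurableSpace E]
    [BorelSpace E] [SecondCountableTopology E] {T : Ω → E} (hT : Measurable T)
    (hTbdd : AEBounded P T) {l : ℝ} (hl : 0 ≤ l) (k : ℕ) :
    Integrable (fun ω => lyapunov l (T ω) ^ k) P := by
  refine integrable_comp_of_aeBounded (f := fun t => lyapunov l t ^ k) hT hTbdd
    ((continuous_lyapunov l).pow k) fun R => ?_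
  obtain ⟨B, -, hB⟩ := exists_forall_norm_lyapunov_le (E := E) hl R
  exact ⟨B ^ k, fun t ht => by rw [norm_pow]; gcongr; exact hB t ht⟩

variable {H : Type*} [NormedAddCommGroup H] [InnerProductSpace ℝ H] [MeasurableSpace H]
  [BorelSpace H] [SecondCountableTopology H] {d : ℕ}

/-- Averaging the drift over an error `T` independent of the observation `Z`, with a nonnegative
weight `f T`. -/
theorem integral_mul_inner_errorDirection_le {T : Ω → HPow H d}
    {Z : Ω → EuclideanSpace ℝ (Fin d) × H} (hT : Measurable T) (hZ : Measurable Z)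
    (hTbdd : AEBounded P T) (hZbdd : AEBounded P fun ω => (Z ω).1) (hind : IndepFun T Z P) {c : ℝ}
    (hc : ∀ t : HPow H d, ∫ z, inner ℝ t (errorDirection z.1 z.2 t) ∂(P.map Z) ≤
      -(c * (‖t‖ ^ 2 / (1 + ‖t‖))))
    {f : HPow H d → ℝ} (hf : Continuous f) (hf0 : ∀ t, 0 ≤ f t)
    (hfbdd : ∀ R : ℝ, ∃ B : ℝ, ∀ t, ‖t‖ ≤ R → ‖f t‖ ≤ B) :
    Integrable (fun ω => f (T ω) * inner ℝ (T ω) (errorDirection (Z ω).1 (Z ω).2 (T ω))) P ∧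
    ∫ ω, f (T ω) * inner ℝ (T ω) (errorDirection (Z ω).1 (Z ω).2 (T ω)) ∂P ≤
      -(c * ∫ ω, f (T ω) * (‖T ω‖ ^ 2 / (1 + ‖T ω‖)) ∂P) := by
  obtain ⟨R, hR⟩ := hTbdd
  obtain ⟨K, hK⟩ := hZbdd
  obtain ⟨B, hB⟩ := hfbdd R
  let F : HPow H d × (EuclideanSpace ℝ (Fin d) × H) → ℝ := fun p =>
    f p.1 * inner ℝ p.1 (errorDirection p.2.1 p.2.2 p.1)
  have hdir : Measurable fun p : HPow H d × (EuclideanSpace ℝ (Fin d) × H) =>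
      errorDirection p.2.1 p.2.2 p.1 :=
    measurable_errorDirection.comp (measurable_snd.prodMk measurable_fst)
  have hF : Measurable F :=
    (hf.measurable.comp measurable_fst).mul (measurable_fst.inner hdir)
  have hTZ := hT.prodMk hZ
  have hmap := (indepFun_iff_map_prod_eq_prod_map_map hT.aemeasurable hZ.aemeasurable).1 hind
  have : IsProbabilityMeasure (P.map T) := Measure.isProbabilityMeasure_map hT.aemeasurable
  have : IsProbabilityMeasure (P.map Z) := Measure.isProbabilityMeasure_map hZ.aemeasurable
  have hint : Integrable (fun ω => F (T ω, Z ω)) P := by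
    refine Integrable.of_bound (C := B * (R * K)) (hF.comp hTZ).aestronglyMeasurable ?_
    filter_upwards [hR, hK] with ω h1 h2
    rw [norm_mul]
    have h3 : ‖inner ℝ (T ω) (errorDirection (Z ω).1 (Z ω).2 (T ω))‖ ≤ R * K :=
      (norm_inner_le_norm _ _).trans (mul_le_mul h1 ((norm_errorDirection_le _ _ _).trans h2)
        (norm_nonneg _) ((norm_nonneg _).trans h1))
    exact mul_le_mul (hB _ h1) h3 (norm_nonneg _) ((norm_nonneg _).trans (hB _ h1))
  refine ⟨hint, ?_⟩
  have hint' : Integrable F ((P.map T).prod (P.map Z)) := by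
    rw [← hmap]
    exact (integrable_map_measure hF.aestronglyMeasurable hTZ.aemeasurable).2 hint
  have hpen : Continuous fun t : HPow H d => f t * (‖t‖ ^ 2 / (1 + ‖t‖)) := by
    refine hf.mul (Continuous.div (by fun_prop) (by fun_prop) fun t => ?_)
    have := norm_nonneg t
    positivity
  have hpenint : Integrable (fun t : HPow H d => f t * (‖t‖ ^ 2 / (1 + ‖t‖))) (P.map T) := by
    rw [integrable_map_measure hpen.measurable.aestronglyMeasurable hT.aemeasurable]
    refine Integrable.of_bound (C := B * R ^ 2) (hpen.measurable.comp hT).aestronglyMeasurable ?_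
    filter_upwards [hR] with ω h1
    have h0 := norm_nonneg (T ω)
    have hq : ‖T ω‖ ^ 2 / (1 + ‖T ω‖) ≤ R ^ 2 :=
      (div_le_self (by positivity) (by linarith)).trans (by gcongr)
    rw [Function.comp_apply, norm_mul, Real.norm_of_nonneg (by positivity :
      0 ≤ ‖T ω‖ ^ 2 / (1 + ‖T ω‖))]
    exact mul_le_mul (hB _ h1) hq (by positivity) ((norm_nonneg _).trans (hB _ h1))
  calc ∫ ω, F (T ω, Z ω) ∂P = ∫ p, F p ∂((P.map T).prod (P.map Z)) := by
        rw [← hmap, integral_map hTZ.aemeasurable hF.aestronglyMeasurable]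
    _ = ∫ t, ∫ z, F (t, z) ∂(P.map Z) ∂(P.map T) := integral_prod _ hint'
    _ ≤ ∫ t, -c * (f t * (‖t‖ ^ 2 / (1 + ‖t‖))) ∂(P.map T) := by
        refine integral_mono hint'.integral_prod_left (hpenint.const_mul _) fun t => ?_
        change ∫ z, f t * inner ℝ t (errorDirection z.1 z.2 t) ∂(P.map Z) ≤ _
        rw [integral_const_mul]
        have := mul_le_mul_of_nonneg_left (hc t) (hf0 t)
        linarith
    _ = -(c * ∫ ω, f (T ω) * (‖T ω‖ ^ 2 / (1 + ‖T ω‖)) ∂P) := by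
        rw [integral_const_mul, integral_map hT.aemeasurable hpen.measurable.aestronglyMeasurable]
        ring

/-- One step of the recursion for the `(k + 1)`-st power of the Lyapunov function, given its
second-order expansion: the linear term contracts. -/
theorem integral_lyapunov_pow_step_le {T : Ω → HPow H d} {Z : Ω → EuclideanSpace ℝ (Fin d) × H}
    (hT : Measurable T) (hZ : Measurable Z) (hTbdd : AEBounded P T) {K : ℝ}
    (hZbdd : ∀ᵐ ω ∂P, ‖(Z ω).1‖ ≤ K) (hind : IndepFun T Z P) {c : ℝ} (hc0 : 0 ≤ c)
    (hc : ∀ t : HPow H d, ∫ z, inner ℝ t (errorDirection z.1 z.2 t) ∂(P.map Z) ≤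
      -(c * (‖t‖ ^ 2 / (1 + ‖t‖))))
    {T' : Ω → HPow H d} {l g m : ℝ} {k : ℕ} (hT' : Measurable T') (hT'bdd : AEBounded P T')
    (hl : 0 ≤ l) (hl1 : l ≤ 1) (hg : 0 ≤ g) (hm : 0 ≤ m)
    (hTT' : ∀ ω, T' ω = T ω + g • errorDirection (Z ω).1 (Z ω).2 (T ω))
    {f : HPow H d → ℝ} (hf : Integrable (fun ω => f (T ω)) P)
    (hexp : ∀ t ξ : HPow H d, ‖ξ‖ ≤ K → lyapunov l (t + g • ξ) ^ (k + 1) ≤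
      lyapunov l t ^ (k + 1) + m * lyapunov l t ^ k *
        ((1 + lyapunov l t) * (l * g / √(1 + ‖t‖ ^ 2))) * inner ℝ t ξ + f t) :
    ∫ ω, lyapunov l (T' ω) ^ (k + 1) ∂P ≤
      (1 - m * l * c / 3 * g) * ∫ ω, lyapunov l (T ω) ^ (k + 1) ∂P + ∫ ω, f (T ω) ∂P := by
  let w : HPow H d → ℝ := fun t => m * lyapunov l t ^ k *
    ((1 + lyapunov l t) * (l * g / √(1 + ‖t‖ ^ 2)))
  have hs0 : ∀ t : HPow H d, √(1 + ‖t‖ ^ 2) ≠ 0 := fun t => by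
    have := one_le_sqrt_one_add_norm_sq t
    linarith
  have hlc := continuous_lyapunov (E := HPow H d) l
  have hw : Continuous w := by
    refine (continuous_const.mul (hlc.pow k)).mul ((continuous_const.add hlc).mul ?_)
    exact Continuous.div continuous_const (by fun_prop) hs0
  have hw0 : ∀ t, 0 ≤ w t := fun t => by
    have := lyapunov_nonneg hl t
    positivity
  have hwbdd : ∀ R : ℝ, ∃ B : ℝ, ∀ t, ‖t‖ ≤ R → ‖w t‖ ≤ B := by
    intro R
    obtain ⟨B, hB0, hB⟩ := exists_forall_norm_lyapunov_le (E := HPow H d) hl R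
    refine ⟨m * B ^ k * ((1 + B) * (l * g)), fun t ht => ?_⟩
    rw [Real.norm_of_nonneg (hw0 t)]
    have h1 := lyapunov_nonneg hl t
    have h2 := hB t ht
    rw [Real.norm_of_nonneg h1] at h2
    have h3 : l * g / √(1 + ‖t‖ ^ 2) ≤ l * g :=
      div_le_self (by positivity) (one_le_sqrt_one_add_norm_sq t)
    simp only [w]
    gcongr
  obtain ⟨hint, hdrift⟩ := integral_mul_inner_errorDirection_le hT hZ hTbdd ⟨K, hZbdd⟩ hind hc
    hw hw0 hwbdd
  have hWint := integrable_lyapunov_pow (P := P) hT hTbdd hl (k + 1)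
  have hpen : ∀ t : HPow H d, m * l * g / 3 * lyapunov l t ^ (k + 1) ≤
      w t * (‖t‖ ^ 2 / (1 + ‖t‖)) := by
    intro t
    have h1 := lyapunov_le_mul_drift hl hl1 t
    have h0 := lyapunov_nonneg hl t
    have h2 := mul_le_mul_of_nonneg_left h1
      (show 0 ≤ m * l * g * lyapunov l t ^ k by positivity)
    calc m * l * g / 3 * lyapunov l t ^ (k + 1)
        = m * l * g * lyapunov l t ^ k * (lyapunov l t / 3) := by ring
      _ ≤ _ := h2
      _ = w t * (‖t‖ ^ 2 / (1 + ‖t‖)) := by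
          have := norm_nonneg t
          simp only [w]
          rw [← div_div]
          ring
  have hpenint : Integrable (fun ω => w (T ω) * (‖T ω‖ ^ 2 / (1 + ‖T ω‖))) P := by
    have hcont : Continuous fun t : HPow H d => w t * (‖t‖ ^ 2 / (1 + ‖t‖)) := by
      refine hw.mul (Continuous.div (by fun_prop) (by fun_prop) fun t => ?_)
      have := norm_nonneg t
      positivity
    refine integrable_comp_of_aeBounded hT hTbdd hcont fun R => ?_
    obtain ⟨B, hB⟩ := hwbdd R
    refine ⟨B * R ^ 2, fun t ht => ?_⟩
    have h0 := norm_nonneg t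
    have hq : ‖t‖ ^ 2 / (1 + ‖t‖) ≤ R ^ 2 :=
      (div_le_self (by positivity) (by linarith)).trans (by gcongr)
    rw [norm_mul, Real.norm_of_nonneg (by positivity : 0 ≤ ‖t‖ ^ 2 / (1 + ‖t‖))]
    exact mul_le_mul (hB _ ht) hq (by positivity) ((norm_nonneg _).trans (hB _ ht))
  have hpenI : m * l * g / 3 * ∫ ω, lyapunov l (T ω) ^ (k + 1) ∂P ≤
      ∫ ω, w (T ω) * (‖T ω‖ ^ 2 / (1 + ‖T ω‖)) ∂P := by
    rw [← integral_const_mul]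
    exact integral_mono (hWint.const_mul _) hpenint fun ω => hpen (T ω)
  have hsum : Integrable (fun ω => lyapunov l (T ω) ^ (k + 1)
      + w (T ω) * inner ℝ (T ω) (errorDirection (Z ω).1 (Z ω).2 (T ω))) P := hWint.add hint
  have hstep : ∫ ω, lyapunov l (T' ω) ^ (k + 1) ∂P ≤
      ∫ ω, (lyapunov l (T ω) ^ (k + 1)
        + w (T ω) * inner ℝ (T ω) (errorDirection (Z ω).1 (Z ω).2 (T ω)) + f (T ω)) ∂P := by
    refine integral_mono_ae (integrable_lyapunov_pow hT' hT'bdd hl (k + 1))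
      (hsum.add hf) ?_
    filter_upwards [hZbdd] with ω hω
    rw [hTT']
    exact hexp _ _ ((norm_errorDirection_le _ _ _).trans hω)
  rw [integral_add hsum hf, integral_add hWint hint] at hstep
  have := mul_le_mul_of_nonneg_left hpenI hc0
  linarith

end Moments

/-! ### Rates of convergence -/

section Rates

variable {Ω : Type*} [MeasurableSpace Ω] {P : Measure Ω}
theorem ae_norm_le_of_identDistrib {E : Type*} [MeasurableSpace E] {d : ℕ}
    {X X' : Ω → EuclideanSpace ℝ (Fin d)} {U U' : Ω → E} {K : ℝ}
    (h : IdentDistrib (fun ω => (X ω, U ω)) (fun ω => (X' ω, U' ω)) P P)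
    (hK : ∀ᵐ ω ∂P, ‖X' ω‖ ≤ K) : ∀ᵐ ω ∂P, ‖X ω‖ ≤ K :=
  h.symm.ae_snd (p := fun z => ‖z.1‖ ≤ K)
    (measurableSet_le (by fun_prop) measurable_const) hK

variable {H : Type*} [NormedAddCommGroup H] [MeasurableSpace H] {d : ℕ}
  [InnerProductSpace ℝ H]

theorem sgdIterate_succ_sub {β : HPow H d} {X : ℕ → Ω → EuclideanSpace ℝ (Fin d)}
    {Y U : ℕ → Ω → H} (hsample : IsSample P β X Y U) (γ α : ℝ) (b₁ : Ω → HPow H d) (n : ℕ)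
    (ω : Ω) :
    sgdIterate γ α X Y b₁ (n + 2) ω - β = (sgdIterate γ α X Y b₁ (n + 1) ω - β)
      + stepSize γ α (n + 1) • errorDirection (X (n + 2) ω) (U (n + 2) ω)
        (sgdIterate γ α X Y b₁ (n + 1) ω - β) := by
  rw [← sgdStep_sub, ← hsample.model (n + 2) (by omega)]
  rfl

theorem aeBounded_sgdIterate_sub {β : HPow H d} {X : ℕ → Ω → EuclideanSpace ℝ (Fin d)}
    {Y U : ℕ → Ω → H} (hsample : IsSample P β X Y U) (hXbdd : AEBounded P (X 1)) (γ α : ℝ)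
    {b₁ : Ω → HPow H d} (hb₁bdd : AEBounded P b₁) (n : ℕ) :
    AEBounded P fun ω => sgdIterate γ α X Y b₁ (n + 1) ω - β := by
  induction n with
  | zero =>
    obtain ⟨R, hR⟩ := hb₁bdd
    exact ⟨R + ‖β‖, hR.mono fun ω hω => (norm_sub_le _ _).trans (by gcongr; exact hω)⟩
  | succ n ih =>
    obtain ⟨R, hR⟩ := ih
    obtain ⟨K, hK⟩ := hXbdd
    refine ⟨R + ‖stepSize γ α (n + 1)‖ * K, ?_⟩
    filter_upwards [hR, ae_norm_le_of_identDistrib (hsample.identDistrib (n + 2) (by omega)) hK]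
      with ω h1 h2
    rw [sgdIterate_succ_sub hsample]
    refine (norm_add_le _ _).trans (add_le_add h1 ?_)
    rw [norm_smul]
    gcongr
    exact (norm_errorDirection_le _ _ _).trans h2

variable [BorelSpace H] [SecondCountableTopology H]

theorem measurable_sgdIterate_sub {β : HPow H d} {X : ℕ → Ω → EuclideanSpace ℝ (Fin d)}
    {Y U : ℕ → Ω → H} (hsample : IsSample P β X Y U) (γ α : ℝ) {b₁ : Ω → HPow H d}
    (hb₁ : Measurable b₁) (n : ℕ) :
    Measurable fun ω => sgdIterate γ α X Y b₁ (n + 1) ω - β := by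
  refine (measurable_sgdIterate γ α hb₁ n (fun i _ => hsample.measurable_X _ (by omega))
    fun i _ => ?_).sub_const β
  have hY : Y (i + 2) = fun ω => dotH (X (i + 2) ω) β + U (i + 2) ω :=
    funext (hsample.model (i + 2) (by omega))
  rw [hY]
  exact (continuous_dotH.measurable.comp ((hsample.measurable_X _ (by omega)).prodMk
    measurable_const)).add (hsample.measurable_U _ (by omega))

variable [IsProbabilityMeasure P]

theorem exists_forall_integral_inner_errorDirection_law_le {β : HPow H d}
    {X : ℕ → Ω → EuclideanSpace ℝ (Fin d)} {Y U : ℕ → Ω → H} (hsample : IsSample P β X Y U)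
    (hXbdd : AEBounded P (X 1)) (hcov : WellConditioned P (X 1))
    (hmedian : IsGeometricMedian P (U 1) 0) (hconc : NotConcentrated P (U 1)) :
    ∃ c : ℝ, 0 < c ∧ ∀ n, 1 ≤ n → ∀ t : HPow H d,
      ∫ z, inner ℝ t (errorDirection z.1 z.2 t) ∂(P.map fun ω => (X n ω, U n ω)) ≤
        -(c * (‖t‖ ^ 2 / (1 + ‖t‖))) := by
  have hX := hsample.measurable_X 1 le_rfl
  have hU := hsample.measurable_U 1 le_rfl
  have : IsProbabilityMeasure (P.map (X 1)) := Measure.isProbabilityMeasure_map hX.aemeasurable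
  have : IsProbabilityMeasure (P.map (U 1)) := Measure.isProbabilityMeasure_map hU.aemeasurable
  obtain ⟨C, -, hC⟩ := hconc
  obtain ⟨c₁, hc₁, h₁⟩ := exists_forall_integral_norm_dotH_sq_ge (H := H) hX hXbdd hcov
  obtain ⟨c₂, hc₂, h₂⟩ := exists_forall_integral_inner_direction_le (μ := P.map (U 1))
    ENNReal.ofReal_ne_top
    (fun h => by rw [lintegral_map (by fun_prop) hU]; exact hC h)
    (fun h => by
      rw [integral_map hU.aemeasurable (by fun_prop)]
      simpa using hmedian h)
  obtain ⟨K, hK⟩ := hXbdd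
  obtain ⟨c, hc, h⟩ := exists_forall_integral_inner_errorDirection_le hc₁ hc₂
    ((ae_map_iff hX.aemeasurable (measurableSet_le (by fun_prop) measurable_const)).2 hK)
    (fun t => by
      have hm : Measurable fun x : EuclideanSpace ℝ (Fin d) => dotH x t :=
        continuous_dotH.measurable.comp (measurable_id.prodMk measurable_const)
      rw [integral_map hX.aemeasurable (by fun_prop)]
      exact h₁ t) h₂
  refine ⟨c, hc, fun n hn t => ?_⟩
  rw [(hsample.identDistrib n hn).map_eq,
    (indepFun_iff_map_prod_eq_prod_map_map hX.aemeasurable hU.aemeasurable).1 hsample.indep_XU]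
  exact h t

/-- The first two moments of the Lyapunov function of the error decay like the step size and its
square. -/
theorem exists_integral_lyapunov_le {β : HPow H d} {X : ℕ → Ω → EuclideanSpace ℝ (Fin d)}
    {Y U : ℕ → Ω → H} (hsample : IsSample P β X Y U) (hXbdd : AEBounded P (X 1))
    (hcov : WellConditioned P (X 1)) (hmedian : IsGeometricMedian P (U 1) 0)
    (hconc : NotConcentrated P (U 1)) {γ α : ℝ} (hγ : 0 < γ) (hα0 : 0 < α) (hα1 : α < 1)
    {b₁ : Ω → HPow H d} (hb₁ : Measurable b₁) (hb₁bdd : AEBounded P b₁)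
    (hb₁indep : IndepFun b₁ (fun ω (i : ℕ) => (X (i + 2) ω, U (i + 2) ω)) P) :
    ∃ l : ℝ, 0 < l ∧ ∃ B : ℝ, 0 ≤ B ∧ ∀ n, 1 ≤ n →
      ∫ ω, lyapunov l (sgdIterate γ α X Y b₁ n ω - β) ∂P ≤ B * stepSize γ α n ∧
      ∫ ω, lyapunov l (sgdIterate γ α X Y b₁ n ω - β) ^ 2 ∂P ≤ B * stepSize γ α n ^ 2 := by
  obtain ⟨c, hc, hdrift⟩ := exists_forall_integral_inner_errorDirection_law_le hsample hXbdd hcov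
    hmedian hconc
  obtain ⟨K, hK0, hK⟩ : ∃ K : ℝ, 0 ≤ K ∧ ∀ᵐ ω ∂P, ‖X 1 ω‖ ≤ K := by
    obtain ⟨K, hK⟩ := hXbdd
    exact ⟨max K 0, le_max_right _ _, hK.mono fun ω h => h.trans (le_max_left _ _)⟩
  -- small enough for the increments of the exponent to stay below `1`
  obtain ⟨l, hl, hl1, hlγ⟩ : ∃ l : ℝ, 0 < l ∧ l ≤ 1 ∧ l * (γ * K + γ ^ 2 * K ^ 2) ≤ 1 := by
    have h0 : 0 ≤ γ * K + γ ^ 2 * K ^ 2 := by positivity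
    refine ⟨(1 + (γ * K + γ ^ 2 * K ^ 2))⁻¹, by positivity, inv_le_one_of_one_le₀ (by linarith), ?_⟩
    rw [inv_mul_le_iff₀ (by positivity)]
    linarith
  obtain ⟨D₁, hD₁, hexp₁⟩ := exists_lyapunov_add_smul_le_linear (E := HPow H d) hl hK0 hlγ
  obtain ⟨D₂, hD₂, hexp₂⟩ := exists_sq_lyapunov_add_smul_le (E := HPow H d) hl hK0 hlγ
  set T : ℕ → Ω → HPow H d := fun n ω => sgdIterate γ α X Y b₁ n ω - β with hTdef
  have hTm : ∀ n, Measurable (T (n + 1)) := measurable_sgdIterate_sub hsample γ α hb₁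
  have hTb : ∀ n, AEBounded P (T (n + 1)) := aeBounded_sgdIterate_sub hsample hXbdd γ α hb₁bdd
  have hZm : ∀ n, Measurable fun ω => (X (n + 2) ω, U (n + 2) ω) := fun n =>
    (hsample.measurable_X _ (by omega)).prodMk (hsample.measurable_U _ (by omega))
  have hZb : ∀ n, ∀ᵐ ω ∂P, ‖X (n + 2) ω‖ ≤ K := fun n =>
    ae_norm_le_of_identDistrib (hsample.identDistrib (n + 2) (by omega)) hK
  have hTZ : ∀ n, IndepFun (T (n + 1)) (fun ω => (X (n + 2) ω, U (n + 2) ω)) P := fun n =>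
    (indepFun_sgdIterate γ α hsample hb₁ hb₁indep n).comp (measurable_id.sub_const β) measurable_id
  have hg0 : ∀ n, 0 ≤ stepSize γ α n := stepSize_nonneg hγ.le α
  have hgγ : ∀ n, 1 ≤ n → stepSize γ α n ≤ γ := fun n hn => stepSize_le hγ.le hα0.le hn
  have hW1 : ∀ n, Integrable (fun ω => lyapunov l (T (n + 1) ω)) P := fun n => by
    simpa using integrable_lyapunov_pow (P := P) (hTm n) (hTb n) hl.le 1
  have hW2 : ∀ n, Integrable (fun ω => lyapunov l (T (n + 1) ω) ^ 2) P := fun n =>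
    integrable_lyapunov_pow (hTm n) (hTb n) hl.le 2
  obtain ⟨B₁, hB₁, h₁⟩ := exists_forall_le_of_recursion (γ := γ) (α := α) (c := l * c / 3)
    (D := D₁) hγ hα0 hα1 (by positivity) 1 (a := fun n => ∫ ω, lyapunov l (T n ω) ∂P)
    (fun n => integral_nonneg fun ω => lyapunov_nonneg hl.le _) (by
      intro n hn
      obtain ⟨n, rfl⟩ := Nat.exists_eq_add_of_le' hn
      have h := integral_lyapunov_pow_step_le (m := 1) (k := 0)
        (f := fun t => D₁ * stepSize γ α (n + 1) ^ 2 * (1 + lyapunov l t)) (hTm n) (hZm n) (hTb n)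
        (hZb n) (hTZ n) hc.le (hdrift (n + 2) (by omega)) (hTm (n + 1)) (hTb (n + 1)) hl.le hl1
        (hg0 (n + 1)) zero_le_one (sgdIterate_succ_sub hsample γ α b₁ n)
        (((integrable_const _).add (hW1 n)).const_mul _)
        (fun t ξ hξ => by simpa using hexp₁ _ (hg0 (n + 1)) (hgγ _ hn) t ξ hξ)
      rw [integral_const_mul, integral_add (integrable_const _) (hW1 n)] at h
      simp only [zero_add, pow_one, one_mul, integral_const, probReal_univ, smul_eq_mul] at h
      linarith)
  obtain ⟨B₂, hB₂, h₂⟩ := exists_forall_le_of_recursion (γ := γ) (α := α) (c := 2 * l * c / 3)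
    (D := D₂ * (1 + B₁ + γ)) hγ hα0 hα1 (by positivity) 2
    (a := fun n => ∫ ω, lyapunov l (T n ω) ^ 2 ∂P)
    (fun n => integral_nonneg fun ω => sq_nonneg _) (by
      intro n hn
      have h1 := h₁ n hn
      have hgn := hgγ n hn
      obtain ⟨n, rfl⟩ := Nat.exists_eq_add_of_le' hn
      have hWW : Integrable (fun ω => lyapunov l (T (n + 1) ω) + lyapunov l (T (n + 1) ω) ^ 2) P :=
        (hW1 n).add (hW2 n)
      have h := integral_lyapunov_pow_step_le (m := 2) (k := 1)
        (f := fun t => D₂ * stepSize γ α (n + 1) ^ 2 * (lyapunov l t + lyapunov l t ^ 2)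
          + D₂ * stepSize γ α (n + 1) ^ 4) (hTm n) (hZm n) (hTb n)
        (hZb n) (hTZ n) hc.le (hdrift (n + 2) (by omega)) (hTm (n + 1)) (hTb (n + 1)) hl.le hl1
        (hg0 (n + 1)) zero_le_two (sgdIterate_succ_sub hsample γ α b₁ n)
        ((hWW.const_mul _).add (integrable_const _))
        (fun t ξ hξ => by
          have := hexp₂ _ (hg0 (n + 1)) (hgγ _ hn) t ξ hξ
          rw [pow_one]
          linarith)
      rw [integral_add (hWW.const_mul _) (integrable_const _), integral_const_mul,
        integral_add (hW1 n) (hW2 n)] at h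
      simp only [Nat.reduceAdd, integral_const, probReal_univ, smul_eq_mul, one_mul] at h
      have ha2 : 0 ≤ ∫ ω, lyapunov l (T (n + 1) ω) ^ 2 ∂P := integral_nonneg fun ω => sq_nonneg _
      have hg := hg0 (n + 1)
      simp only [pow_one] at h1
      set g := stepSize γ α (n + 1)
      set a₁ := ∫ ω, lyapunov l (T (n + 1) ω) ∂P
      set a₂ := ∫ ω, lyapunov l (T (n + 1) ω) ^ 2 ∂P
      have e1 : D₂ * g ^ 2 * a₁ ≤ D₂ * g ^ 2 * (B₁ * g) := by gcongr
      have e2 : D₂ * g ^ 4 ≤ D₂ * (g ^ 3 * γ) := by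
        rw [pow_succ]; gcongr
      have e3 : 0 ≤ D₂ * (B₁ + γ) * g ^ 2 * a₂ := by positivity
      have e4 : 0 ≤ D₂ * g ^ 3 := by positivity
      change ∫ ω, lyapunov l (T (n + 1 + 1) ω) ^ 2 ∂P ≤ _
      linarith)
  refine ⟨l, hl, max B₁ B₂, hB₁.trans (le_max_left _ _), fun n hn => ⟨?_, ?_⟩⟩
  · refine (h₁ n hn).trans ?_
    rw [pow_one]
    exact mul_le_mul_of_nonneg_right (le_max_left _ _) (hg0 n)
  · exact (h₂ n hn).trans (mul_le_mul_of_nonneg_right (le_max_right _ _) (sq_nonneg _))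

end Rates


end FunctionOnScalar

open FunctionOnScalar

theorem theorem1
    {Ω : Type*} [MeasurableSpace Ω] (P : Measure Ω) [IsProbabilityMeasure P]
    {H : Type*} [NormedAddCommGroup H] [InnerProductSpace ℝ H] [CompleteSpace H]
    [TopologicalSpace.SeparableSpace H] [MeasurableSpace H] [BorelSpace H]
    {d : ℕ} (β : FunctionOnScalar.HPow H d)
    (X : ℕ → Ω → EuclideanSpace ℝ (Fin d)) (Y U : ℕ → Ω → H)
    (hsample : FunctionOnScalar.IsSample P β X Y U)
    (hXbdd : FunctionOnScalar.AEBounded P (X 1))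
    (hcov : FunctionOnScalar.WellConditioned P (X 1))
    (hmedian : FunctionOnScalar.HasUniqueZeroMedian P (U 1))
    (hconc : FunctionOnScalar.NotConcentrated P (U 1))
    (γ α : ℝ) (hγ : 0 < γ) (hα : α < 1)
    (hstep : FunctionOnScalar.RobbinsMonro (FunctionOnScalar.stepSize γ α))
    (b₁ : Ω → FunctionOnScalar.HPow H d) (hb₁ : Measurable b₁)
    (hb₁bdd : FunctionOnScalar.AEBounded P b₁)
    (hb₁indep : IndepFun b₁ (fun ω (i : ℕ) => (X (i + 2) ω, U (i + 2) ω)) P) :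
    ((∀ n : ℕ, 1 ≤ n →
        Integrable (fun ω => ‖FunctionOnScalar.sgdIterate γ α X Y b₁ n ω - β‖ ^ 2) P) ∧
      (fun n : ℕ => ∫ ω, ‖FunctionOnScalar.sgdIterate γ α X Y b₁ n ω - β‖ ^ 2 ∂P)
        =O[atTop] (fun n : ℕ => (n : ℝ) ^ (-α))) ∧
    ((∀ n : ℕ, 1 ≤ n →
        Integrable (fun ω => ‖FunctionOnScalar.sgdIterate γ α X Y b₁ n ω - β‖ ^ 4) P) ∧
      ∀ θ : ℝ, θ ∈ Set.Ioo α (2 * α) →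
        (fun n : ℕ => ∫ ω, ‖FunctionOnScalar.sgdIterate γ α X Y b₁ n ω - β‖ ^ 4 ∂P)
          =O[atTop] (fun n : ℕ => (n : ℝ) ^ (-θ))) := by
  have : SecondCountableTopology H := UniformSpace.secondCountable_of_separable H
  have hα0 : 0 < α := by linarith [half_lt_of_robbinsMonro hγ hstep]
  obtain ⟨l, hl, B, hB, hrate⟩ := exists_integral_lyapunov_le hsample hXbdd hcov hmedian.1 hconc
    hγ hα0 hα hb₁ hb₁bdd hb₁indep
  have hTm := measurable_sgdIterate_sub hsample γ α hb₁
  have hTb := aeBounded_sgdIterate_sub hsample hXbdd γ α hb₁bdd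
  have hint : ∀ k n : ℕ, 1 ≤ n →
      Integrable (fun ω => ‖sgdIterate γ α X Y b₁ n ω - β‖ ^ k) P := by
    intro k n hn
    obtain ⟨n, rfl⟩ := Nat.exists_eq_add_of_le' hn
    refine integrable_comp_of_aeBounded (f := fun t => ‖t‖ ^ k) (hTm n) (hTb n) (by fun_prop)
      fun R => ⟨R ^ k, fun t ht => ?_⟩
    rw [norm_pow, norm_norm]
    gcongr
  set κ := 2 / l + 2 / l ^ 2
  have hκ : 0 ≤ κ := by positivity
  have h2 : ∀ n : ℕ, 1 ≤ n → ∫ ω, ‖sgdIterate γ α X Y b₁ n ω - β‖ ^ 2 ∂P ≤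
      κ * (B * stepSize γ α n) := by
    intro n hn
    refine le_trans ?_ (mul_le_mul_of_nonneg_left (hrate n hn).1 hκ)
    rw [← integral_const_mul]
    refine integral_mono (hint 2 n hn) (Integrable.const_mul ?_ κ)
      fun ω => norm_sq_le_lyapunov hl _
    obtain ⟨n, rfl⟩ := Nat.exists_eq_add_of_le' hn
    simpa using integrable_lyapunov_pow (P := P) (hTm n) (hTb n) hl.le 1
  have h4 : ∀ n : ℕ, 1 ≤ n → ∫ ω, ‖sgdIterate γ α X Y b₁ n ω - β‖ ^ 4 ∂P ≤
      κ ^ 2 * (B * stepSize γ α n ^ 2) := by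
    intro n hn
    refine le_trans ?_ (mul_le_mul_of_nonneg_left (hrate n hn).2 (sq_nonneg κ))
    rw [← integral_const_mul]
    refine integral_mono (hint 4 n hn) (Integrable.const_mul ?_ (κ ^ 2)) fun ω => ?_
    · obtain ⟨n, rfl⟩ := Nat.exists_eq_add_of_le' hn
      exact integrable_lyapunov_pow (hTm n) (hTb n) hl.le 2
    · have h := pow_le_pow_left₀ (sq_nonneg _)
        (norm_sq_le_lyapunov hl (sgdIterate γ α X Y b₁ n ω - β)) 2
      rwa [← pow_mul, mul_pow] at h
  refine ⟨⟨hint 2, ?_⟩, hint 4, fun θ hθ => ?_⟩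
  · refine IsBigO.of_bound (κ * (B * γ)) ?_
    filter_upwards [eventually_ge_atTop 1] with n hn
    rw [Real.norm_of_nonneg (integral_nonneg fun ω => by positivity),
      Real.norm_of_nonneg (by positivity)]
    refine (h2 n hn).trans_eq ?_
    rw [stepSize]
    ring
  · refine IsBigO.of_bound (κ ^ 2 * (B * γ ^ 2)) ?_
    filter_upwards [eventually_ge_atTop 1] with n hn
    rw [Real.norm_of_nonneg (integral_nonneg fun ω => by positivity),
      Real.norm_of_nonneg (by positivity)]
    have e : stepSize γ α n ^ 2 = γ ^ 2 * (n : ℝ) ^ (-(2 * α)) := by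
      rw [stepSize, mul_pow, ← Real.rpow_two ((n : ℝ) ^ (-α)), ← Real.rpow_mul (Nat.cast_nonneg n)]
      ring_nf
    have hle : (n : ℝ) ^ (-(2 * α)) ≤ (n : ℝ) ^ (-θ) :=
      Real.rpow_le_rpow_of_exponent_le (by exact_mod_cast hn) (by linarith [hθ.2])
    refine (h4 n hn).trans ?_
    rw [e]
    calc κ ^ 2 * (B * (γ ^ 2 * (n : ℝ) ^ (-(2 * α))))
        = κ ^ 2 * (B * γ ^ 2) * (n : ℝ) ^ (-(2 * α)) := by ring
      _ ≤ _ := by gcongr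

end
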